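/- **Theorem 3.3.** Let $F:(M^m,g_M)\to(N^n,g_N)$ be a Riemannian map between smooth Riemannian manifolds, i.e. $F$ is smooth and $g_N(F_*X,F_*Y)=g_M(X,Y)$ for $X,Y\in(\ker F_*)^\perp$. Assume that $\mathrm{range}\,F_*$ is a smooth distribution on an open neighbourhood $O$ of $F(M)$ in $N$: there is a smooth subbundle $D$ of $TN|_O$ with $D_{F(p)}=F_{*p}(T_pM)$ for all $p\in M$. Write $\Gamma(\mathrm{range}\,F_*)$ and $\Gamma((\mathrm{range}\,F_*)^\perp)$ for the local sections of $D$ and $D^\perp$, let $P$ and $P^\perp$ be the orthogonal projections onto $D$ and $D^\perp$, and assume that $(\mathrm{range}\,F_*)^\perp=D^\perp$ is totally geodesic: $P(\nabla^N_UV)=0$ for all local sections $U,V$ of $D^\perp$. For a vector field $A$ on $N$ and $V\in\Gamma((\mathrm{range}\,F_*)^\perp)$ put $\mathcal S_VA=-P(\nabla^N_AV)$ and $\nabla^{F\perp}_AV=P^\perp(\nabla^N_AV)$; for a vector field (or tangent vector) $X$ on $M$ put $\nabla^{F\perp}_XV=\nabla^{F\perp}_{F_*X}V$. Let ${}^*F_*$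 be the adjoint of $F_*$, and put $$(\tilde\nabla_X\mathcal S)_VF_*Y=F_*\big(\nabla^M_X\,{}^*F_*(\mathcal S_VF_*Y)\big)-\mathcal S_{\nabla^{F\perp}_XV}F_*Y-\mathcal S_VP\,\nabla^N_{F_*X}F_*Y .$$ Let $R^N(A,B)C=\nabla^N_A\nabla^N_BC-\nabla^N_B\nabla^N_AC-\nabla^N_{[A,B]}C$ and $Ric(A,B)=\mathrm{trace}(Z\mapsto R^N(Z,A)B)$. For a distribution $\Delta$ let $Ric^{\Delta}(A,B)=\mathrm{trace}_{\Delta}\big(Z\mapsto \mathrm{pr}_\Delta R^N(Z,A)B\big)=\sum_i g_N(R^N(\delta_i,A)B,\delta_i)$ for an orthonormal basis $\{\delta_i\}$ of $\Delta$. Let $p\in M$; near $p$ and $F(p)$ let $X,Y,X_1,\dots,X_d\in\Gamma((\ker F_*)^\perp)$ be such that $F_*X,F_*Y,F_*X_j\in\Gamma(\mathrm{range}\,F_*)$ (as vector fields on $N$), let $V,W\in\Gamma((\mathrm{range}\,F_*)^\perp)$, and let $\{F_*X_j\}_{1\le j\le d}$ and $\{e_k\}_{1\le k\le n_1}$ be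 local orthonormal frames of $\mathrm{range}\,F_*$ and $(\mathrm{range}\,F_*)^\perp$. Then, at $F(p)$, $$Ric(F_*X,F_*Y)=Ric^{\mathrm{range}F_*}(F_*X,F_*Y)-\sum_{k}\Big\{g_N(\mathcal S_{\nabla^{F\perp}_{e_k}e_k}F_*X,F_*Y)-g_N(\nabla^N_{e_k}\mathcal S_{e_k}F_*X,F_*Y)+g_N(\mathcal S_{e_k}F_*X,\mathcal S_{e_k}F_*Y)+g_N(\nabla^N_{e_k}F_*X,\mathcal S_{e_k}F_*Y)\Big\},$$ $$Ric(V,W)=Ric^{(\mathrm{range}F_*)^\perp}(V,W)-\sum_{j}\Big\{g_N(\mathcal S_{\nabla^{F\perp}_VW}F_*X_j,F_*X_j)+g_N(\mathcal S_VF_*X_j,\mathcal S_WF_*X_j)-V\big(g_N(\mathcal S_WF_*X_j,F_*X_j)\big)+2g_N(\mathcal S_WF_*X_j,\nabla^N_VF_*X_j)\Big\},$$ where $Ric^{(\mathrm{range}F_*)^\perp}(V,W)=\sum_k g_N(R^{F\perp}(e_k,V)W,e_k)$ is also the intrinsic Ricci tensor, that of the connection $\nabla^{F\perp}$, with $R^{F\perp}(U,V)W=\nabla^{F\perp}_U\nabla^{F\perp}_VW-\nabla^{F\perp}_V\nabla^{F\perp}_UW-\nabla^{F\perp}_{[U,V]}W$;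 and $$Ric(F_*X,V)=\sum_j\Big\{g_N((\tilde\nabla_X\mathcal S)_VF_*X_j,F_*X_j)-g_N((\tilde\nabla_{X_j}\mathcal S)_VF_*X,F_*X_j)\Big\}-\sum_k g_N\Big(\nabla^{F\perp}_X\nabla^{F\perp}_{e_k}V-\nabla^{F\perp}_{e_k}\nabla^{F\perp}_XV-\nabla^{F\perp}_{\nabla^{F\perp}_Xe_k}V+\nabla^{F\perp}_{{}^*F_*(\mathcal S_{e_k}F_*X)}V+\nabla^{F\perp}_{{}^*F_*(\nabla^N_{e_k}F_*X)}V,\;e_k\Big).$$ -/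

import Mathlib

open scoped Manifold ContDiff Bundle Topology

noncomputable section

namespace RiemGeom

section Connection

variable {E : Type*} [NormedAddCommGroup E] [NormedSpace ℝ E]
  {H : Type*} [TopologicalSpace H] {I : ModelWithCorners ℝ E H}
  {M : Type*} [TopologicalSpace M] [ChartedSpace H M]

instance finiteDimensional_tangentSpace [FiniteDimensional ℝ E] (x : M) :
    FiniteDimensional ℝ (TangentSpace I x) :=
  inferInstanceAs (FiniteDimensional ℝ E)

variable [IsManifold I ∞ M] [Bundle.RiemannianBundle (fun x : M ↦ TangentSpace I x)]

theorem ext_inner_extend {x : M} {u v : TangentSpace I x}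
    (h : ∀ Z : Π x : M, TangentSpace I x, MDiffAt (T% Z) x →
      inner ℝ u (Z x) = inner ℝ v (Z x)) : u = v := by
  refine ext_inner_right ℝ fun w ↦ ?_
  simpa using h (FiberBundle.extend E w) (FiberBundle.mdifferentiableAt_extend ..)

/-- The right-hand side of the Koszul formula, that is, `2 g(∇_X Y, Z)` at the point `x`. -/
def koszul (X Y Z : Π x : M, TangentSpace I x) (x : M) : ℝ :=
  mvfderiv I (fun y ↦ inner ℝ (Y y) (Z y)) x (X x)
    + mvfderiv I (fun y ↦ inner ℝ (Z y) (X y)) x (Y x)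
    - mvfderiv I (fun y ↦ inner ℝ (X y) (Y y)) x (Z x)
    + inner ℝ (VectorField.mlieBracket I X Y x) (Z x)
    - inner ℝ (VectorField.mlieBracket I X Z x) (Y x)
    - inner ℝ (VectorField.mlieBracket I Y Z x) (X x)

variable [IsContMDiffRiemannianBundle I ∞ E (fun x : M ↦ TangentSpace I x)]

theorem mdifferentiableAt_inner {Y Z : Π x : M, TangentSpace I x} {x : M}
    (hY : MDiffAt (T% Y) x) (hZ : MDiffAt (T% Z) x) :
    MDiffAt (fun y ↦ (inner ℝ (Y y) (Z y) : ℝ)) x :=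
  MDifferentiableAt.inner_bundle (IB := I) (F := E) (E := fun x : M ↦ TangentSpace I x)
    (b := id) (v := Y) (w := Z) hY hZ

variable [FiniteDimensional ℝ E]

theorem koszul_tensorial_left {Y Z : Π x : M, TangentSpace I x} {x : M}
    (hY : MDiffAt (T% Y) x) (hZ : MDiffAt (T% Z) x) :
    TensorialAt I E (fun X ↦ koszul X Y Z x) x where
  smul {f X} hf hX := by
    have e1 : mvfderiv I (fun y ↦ inner ℝ (Z y) ((f • X) y)) x (Y x)
        = f x * mvfderiv I (fun y ↦ inner ℝ (Z y) (X y)) x (Y x)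
          + inner ℝ (Z x) (X x) * mvfderiv I f x (Y x) := by
      simp [inner_smul_right, mvfderiv_fun_mul hf (mdifferentiableAt_inner hZ hX)]
    have e2 : mvfderiv I (fun y ↦ inner ℝ ((f • X) y) (Y y)) x (Z x)
        = f x * mvfderiv I (fun y ↦ inner ℝ (X y) (Y y)) x (Z x)
          + inner ℝ (X x) (Y x) * mvfderiv I f x (Z x) := by
      simp [inner_smul_left, mvfderiv_fun_mul hf (mdifferentiableAt_inner hX hY)]
    simp only [koszul, e1, e2, VectorField.mlieBracket_smul_left hf hX]
    simp [inner_add_left, inner_smul_left, inner_smul_right, real_inner_comm]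
    ring
  add {X X'} hX hX' := by
    have e1 : mvfderiv I (fun y ↦ inner ℝ (Z y) ((X + X') y)) x (Y x)
        = mvfderiv I (fun y ↦ inner ℝ (Z y) (X y)) x (Y x)
          + mvfderiv I (fun y ↦ inner ℝ (Z y) (X' y)) x (Y x) := by
      simp [inner_add_right, mvfderiv_fun_add (mdifferentiableAt_inner hZ hX) (mdifferentiableAt_inner hZ hX')]
    have e2 : mvfderiv I (fun y ↦ inner ℝ ((X + X') y) (Y y)) x (Z x)
        = mvfderiv I (fun y ↦ inner ℝ (X y) (Y y)) x (Z x)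
          + mvfderiv I (fun y ↦ inner ℝ (X' y) (Y y)) x (Z x) := by
      simp [inner_add_left, mvfderiv_fun_add (mdifferentiableAt_inner hX hY) (mdifferentiableAt_inner hX' hY)]
    simp only [koszul, e1, e2, VectorField.mlieBracket_add_left hX hX']
    simp [inner_add_left, inner_add_right]
    ring

theorem koszul_tensorial_right {X Y : Π x : M, TangentSpace I x} {x : M}
    (hX : MDiffAt (T% X) x) (hY : MDiffAt (T% Y) x) :
    TensorialAt I E (fun Z ↦ koszul X Y Z x) x where
  smul {f Z} hf hZ := by
    have e1 : mvfderiv I (fun y ↦ inner ℝ ((f • Z) y) (X y)) x (Y x)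
        = f x * mvfderiv I (fun y ↦ inner ℝ (Z y) (X y)) x (Y x)
          + inner ℝ (Z x) (X x) * mvfderiv I f x (Y x) := by
      simp [inner_smul_left, mvfderiv_fun_mul hf (mdifferentiableAt_inner hZ hX)]
    have e2 : mvfderiv I (fun y ↦ inner ℝ (Y y) ((f • Z) y)) x (X x)
        = f x * mvfderiv I (fun y ↦ inner ℝ (Y y) (Z y)) x (X x)
          + inner ℝ (Y x) (Z x) * mvfderiv I f x (X x) := by
      simp [inner_smul_right, mvfderiv_fun_mul hf (mdifferentiableAt_inner hY hZ)]
    simp only [koszul, e1, e2, VectorField.mlieBracket_smul_right hf hZ]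
    simp [inner_add_left, inner_smul_left, inner_smul_right, real_inner_comm]
    ring
  add {Z Z'} hZ hZ' := by
    have e1 : mvfderiv I (fun y ↦ inner ℝ ((Z + Z') y) (X y)) x (Y x)
        = mvfderiv I (fun y ↦ inner ℝ (Z y) (X y)) x (Y x)
          + mvfderiv I (fun y ↦ inner ℝ (Z' y) (X y)) x (Y x) := by
      simp [inner_add_left, mvfderiv_fun_add (mdifferentiableAt_inner hZ hX) (mdifferentiableAt_inner hZ' hX)]
    have e2 : mvfderiv I (fun y ↦ inner ℝ (Y y) ((Z + Z') y)) x (X x)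
        = mvfderiv I (fun y ↦ inner ℝ (Y y) (Z y)) x (X x)
          + mvfderiv I (fun y ↦ inner ℝ (Y y) (Z' y)) x (X x) := by
      simp [inner_add_right, mvfderiv_fun_add (mdifferentiableAt_inner hY hZ) (mdifferentiableAt_inner hY hZ')]
    simp only [koszul, e1, e2, VectorField.mlieBracket_add_right hZ hZ']
    simp [inner_add_left, inner_add_right]
    ring

open Classical in
/-- `(v, w) ↦ g(∇_v Y, w)` at `x`, given by the Koszul formula (zero if `Y` is not
differentiable at `x`). -/
def koszulForm (Y : Π x : M, TangentSpace I x) (x : M) :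
    TangentSpace I x →L[ℝ] TangentSpace I x →L[ℝ] ℝ :=
  if hY : MDiffAt (T% Y) x then
    (1 / 2 : ℝ) • TensorialAt.mkHom₂ (fun X Z ↦ koszul X Y Z x) x
      (fun _ hZ ↦ koszul_tensorial_left hY hZ) (fun _ hX ↦ koszul_tensorial_right hX hY)
  else 0

theorem koszulForm_apply {X Y Z : Π x : M, TangentSpace I x} {x : M}
    (hX : MDiffAt (T% X) x) (hY : MDiffAt (T% Y) x) (hZ : MDiffAt (T% Z) x) :
    koszulForm Y x (X x) (Z x) = (1 / 2 : ℝ) * koszul X Y Z x := by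
  have := TensorialAt.mkHom₂_apply (Φ := fun X Z ↦ koszul X Y Z x)
      (fun _ hZ ↦ koszul_tensorial_left hY hZ) (fun _ hX ↦ koszul_tensorial_right hX hY) hX hZ
  simp only [koszulForm, hY, dite_true]
  simp [this]

/-- The vector-valued one-form `v ↦ ∇_v Y` at `x`. -/
def leviCivitaAux (Y : Π x : M, TangentSpace I x) (x : M) :
    TangentSpace I x →L[ℝ] TangentSpace I x :=
  LinearMap.toContinuousLinearMap
    { toFun := fun v ↦ (InnerProductSpace.toDual ℝ (TangentSpace I x)).symm (koszulForm Y x v)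
      map_add' := fun v w ↦ by simp
      map_smul' := fun c v ↦ by simp }

theorem inner_leviCivitaAux (Y : Π x : M, TangentSpace I x) (x : M) (v w : TangentSpace I x) :
    inner ℝ (leviCivitaAux Y x v) w = koszulForm Y x v w := by
  simp [leviCivitaAux]

theorem inner_leviCivitaAux_eq {X Y Z : Π x : M, TangentSpace I x} {x : M}
    (hX : MDiffAt (T% X) x) (hY : MDiffAt (T% Y) x) (hZ : MDiffAt (T% Z) x) :
    inner ℝ (leviCivitaAux Y x (X x)) (Z x) = (1 / 2 : ℝ) * koszul X Y Z x := by
  rw [inner_leviCivitaAux, koszulForm_apply hX hY hZ]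

/-- The Levi-Civita connection of a Riemannian manifold; `leviCivita Y x v` is `∇_v Y` at `x`. -/
def leviCivita : CovariantDerivative I E (TangentSpace I : M → Type _) where
  toFun := leviCivitaAux
  isCovariantDerivativeOnUniv :=
    { add := fun {Y Y' x} hY hY' _ ↦ by
        ext1 v
        refine ext_inner_extend fun Z hZ ↦ ?_
        have hX := FiberBundle.mdifferentiableAt_extend I E (V := fun x : M ↦ TangentSpace I x) v
        have hS := mdifferentiableAt_add_section hY hY'
        have key := inner_leviCivitaAux_eq hX hS hZ
        have k1 := inner_leviCivitaAux_eq hX hY hZ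
        have k2 := inner_leviCivitaAux_eq hX hY' hZ
        simp only [FiberBundle.extend_apply_self] at key k1 k2
        rw [add_apply, inner_add_left, k1, k2]
        refine key.trans ?_
        set X := FiberBundle.extend E (E := fun x : M ↦ TangentSpace I x) v
        have e1 : mvfderiv I (fun y ↦ inner ℝ ((Y + Y') y) (Z y)) x (X x)
            = mvfderiv I (fun y ↦ inner ℝ (Y y) (Z y)) x (X x)
              + mvfderiv I (fun y ↦ inner ℝ (Y' y) (Z y)) x (X x) := by
          simp [inner_add_left,
            mvfderiv_fun_add (mdifferentiableAt_inner hY hZ) (mdifferentiableAt_inner hY' hZ)]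
        have e2 : mvfderiv I (fun y ↦ inner ℝ (X y) ((Y + Y') y)) x (Z x)
            = mvfderiv I (fun y ↦ inner ℝ (X y) (Y y)) x (Z x)
              + mvfderiv I (fun y ↦ inner ℝ (X y) (Y' y)) x (Z x) := by
          simp [inner_add_right,
            mvfderiv_fun_add (mdifferentiableAt_inner hX hY) (mdifferentiableAt_inner hX hY')]
        have e3 : koszul X (Y + Y') Z x = koszul X Y Z x + koszul X Y' Z x := by
          simp only [koszul, e1, e2, VectorField.mlieBracket_add_left hY hY',
            VectorField.mlieBracket_add_right hY hY']
          simp [inner_add_left, inner_add_right]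
          ring
        exact (congrArg ((1 / 2 : ℝ) * ·) e3).trans (mul_add _ _ _)
      leibniz := fun {Y g x} hY hg _ ↦ by
        ext1 v
        refine ext_inner_extend fun Z hZ ↦ ?_
        have hX := FiberBundle.mdifferentiableAt_extend I E (V := fun x : M ↦ TangentSpace I x) v
        have hS := hg.smul_section hY
        have key := inner_leviCivitaAux_eq hX hS hZ
        have k1 := inner_leviCivitaAux_eq hX hY hZ
        have hv : FiberBundle.extend E (E := fun x : M ↦ TangentSpace I x) v x = v :=
          FiberBundle.extend_apply_self ..
        rw [hv] at key k1
        rw [add_apply, inner_add_left, smul_apply,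
          inner_smul_left, k1, ContinuousLinearMap.smulRight_apply, inner_smul_left]
        refine key.trans ?_
        set X := FiberBundle.extend E (E := fun x : M ↦ TangentSpace I x) v
        have e1 : mvfderiv I (fun y ↦ inner ℝ ((g • Y) y) (Z y)) x (X x)
            = g x * mvfderiv I (fun y ↦ inner ℝ (Y y) (Z y)) x (X x)
              + inner ℝ (Y x) (Z x) * mvfderiv I g x (X x) := by
          simp [inner_smul_left, mvfderiv_fun_mul hg (mdifferentiableAt_inner hY hZ)]
        have e2 : mvfderiv I (fun y ↦ inner ℝ (X y) ((g • Y) y)) x (Z x)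
            = g x * mvfderiv I (fun y ↦ inner ℝ (X y) (Y y)) x (Z x)
              + inner ℝ (X x) (Y x) * mvfderiv I g x (Z x) := by
          simp [inner_smul_right, mvfderiv_fun_mul hg (mdifferentiableAt_inner hX hY)]
        have e3 : koszul X (g • Y) Z x
            = g x * koszul X Y Z x + 2 * (mvfderiv I g x (X x) * inner ℝ (Y x) (Z x)) := by
          simp only [koszul, e1, e2, VectorField.mlieBracket_smul_left hg hY,
            VectorField.mlieBracket_smul_right hg hY]
          simp [inner_add_left, inner_smul_left, inner_smul_right, real_inner_comm]
          ring
        refine (congrArg ((1 / 2 : ℝ) * ·) e3).trans ?_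
        simp only [hv, conj_trivial]
        ring }

theorem inner_leviCivita {X Y Z : Π x : M, TangentSpace I x} {x : M}
    (hX : MDiffAt (T% X) x) (hY : MDiffAt (T% Y) x) (hZ : MDiffAt (T% Z) x) :
    inner ℝ (leviCivita Y x (X x)) (Z x) = (1 / 2 : ℝ) * koszul X Y Z x :=
  inner_leviCivitaAux_eq hX hY hZ

/-- The Levi-Civita connection is torsion-free. -/
theorem leviCivita_torsion {X Y : Π x : M, TangentSpace I x} {x : M}
    (hX : MDiffAt (T% X) x) (hY : MDiffAt (T% Y) x) :
    leviCivita Y x (X x) - leviCivita X x (Y x) = VectorField.mlieBracket I X Y x := by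
  refine ext_inner_extend fun Z hZ ↦ ?_
  rw [inner_sub_left, inner_leviCivita hX hY hZ, inner_leviCivita hY hX hZ]
  have h1 : (fun y ↦ (inner ℝ (Z y) (X y) : ℝ)) = fun y ↦ inner ℝ (X y) (Z y) :=
    funext fun y ↦ real_inner_comm _ _
  have h2 : (fun y ↦ (inner ℝ (Z y) (Y y) : ℝ)) = fun y ↦ inner ℝ (Y y) (Z y) :=
    funext fun y ↦ real_inner_comm _ _
  have h3 : (fun y ↦ (inner ℝ (Y y) (X y) : ℝ)) = fun y ↦ inner ℝ (X y) (Y y) :=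
    funext fun y ↦ real_inner_comm _ _
  simp only [koszul, h1, h2, h3, VectorField.mlieBracket_swap_apply (V := Y) (W := X),
    inner_neg_left]
  ring

/-- The Levi-Civita connection is compatible with the metric. -/
theorem leviCivita_metric {X Y Z : Π x : M, TangentSpace I x} {x : M}
    (hX : MDiffAt (T% X) x) (hY : MDiffAt (T% Y) x) (hZ : MDiffAt (T% Z) x) :
    mvfderiv I (fun y ↦ (inner ℝ (Y y) (Z y) : ℝ)) x (X x)
      = inner ℝ (leviCivita Y x (X x)) (Z x) + inner ℝ (Y x) (leviCivita Z x (X x)) := by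
  rw [← real_inner_comm (Y x), inner_leviCivita hX hY hZ, inner_leviCivita hX hZ hY]
  have h1 : (fun y ↦ (inner ℝ (Z y) (X y) : ℝ)) = fun y ↦ inner ℝ (X y) (Z y) :=
    funext fun y ↦ real_inner_comm _ _
  have h2 : (fun y ↦ (inner ℝ (Z y) (Y y) : ℝ)) = fun y ↦ inner ℝ (Y y) (Z y) :=
    funext fun y ↦ real_inner_comm _ _
  have h3 : (fun y ↦ (inner ℝ (Y y) (X y) : ℝ)) = fun y ↦ inner ℝ (X y) (Y y) :=
    funext fun y ↦ real_inner_comm _ _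
  simp only [koszul, h1, h2, h3, VectorField.mlieBracket_swap_apply (V := Z) (W := Y),
    inner_neg_left]
  ring

end Connection

section Curvature

variable {E : Type*} [NormedAddCommGroup E] [NormedSpace ℝ E] [FiniteDimensional ℝ E]
  {H : Type*} [TopologicalSpace H] {I : ModelWithCorners ℝ E H}
  {M : Type*} [TopologicalSpace M] [ChartedSpace H M] [IsManifold I ∞ M]
  [Bundle.RiemannianBundle (fun x : M ↦ TangentSpace I x)]
  [IsContMDiffRiemannianBundle I ∞ E (fun x : M ↦ TangentSpace I x)]

/-- The vector field `∇_X Y`. -/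
def nabla (X Y : Π x : M, TangentSpace I x) (x : M) : TangentSpace I x :=
  leviCivita Y x (X x)

/-- `R(X, Y) Z = ∇_X ∇_Y Z - ∇_Y ∇_X Z - ∇_[X, Y] Z` for vector fields. -/
def curvature (X Y Z : Π x : M, TangentSpace I x) (x : M) : TangentSpace I x :=
  nabla X (nabla Y Z) x - nabla Y (nabla X Z) x - nabla (VectorField.mlieBracket I X Y) Z x

/-- The curvature tensor on tangent vectors at `x`, computed on vector fields that extend them
smoothly near `x`. -/
def curvatureAt (x : M) (u v w : TangentSpace I x) : TangentSpace I x :=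
  curvature (I := I) (FiberBundle.extend E u) (FiberBundle.extend E v) (FiberBundle.extend E w) x

/-- The partial trace `trace (z ↦ pr_K (R(z, u) v))` over `z ∈ K` of the curvature tensor on a
subspace `K` of the tangent space at `x`. -/
def partialRicci {x : M} (K : Submodule ℝ (TangentSpace I x)) (u v : TangentSpace I x) : ℝ :=
  ∑ i, inner ℝ (curvatureAt x (stdOrthonormalBasis ℝ K i : TangentSpace I x) u v)
    (stdOrthonormalBasis ℝ K i : TangentSpace I x)

/-- The Ricci tensor `Ric(u, v) = trace (z ↦ R(z, u) v)`. -/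
def ricci (x : M) (u v : TangentSpace I x) : ℝ :=
  ∑ i, inner ℝ (curvatureAt x (stdOrthonormalBasis ℝ (TangentSpace I x) i) u v)
    (stdOrthonormalBasis ℝ (TangentSpace I x) i)

end Curvature

section Distribution

variable {E : Type*} [NormedAddCommGroup E] [NormedSpace ℝ E] [FiniteDimensional ℝ E]
  {H : Type*} [TopologicalSpace H] {I : ModelWithCorners ℝ E H}
  {N : Type*} [TopologicalSpace N] [ChartedSpace H N] [IsManifold I ∞ N]

/-- `D` is a smooth distribution (subbundle of the tangent bundle) on the set `O`: near every
point of `O` it is spanned by a smooth local frame. -/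
def IsSmoothDistributionOn (D : Π y : N, Submodule ℝ (TangentSpace I y)) (O : Set N) : Prop :=
  ∀ y ∈ O, ∃ (k : ℕ) (s : Fin k → Π z : N, TangentSpace I z), ∀ᶠ z in 𝓝 y,
    (∀ i, CMDiffAt ∞ (T% (s i)) z) ∧ LinearIndependent ℝ (fun i ↦ s i z) ∧
      Submodule.span ℝ (Set.range fun i ↦ s i z) = D z

/-- `A` is near `y` a smooth section of `D`, that is, a local section of `D` around `y`. -/
def IsSectionNear (D : Π y : N, Submodule ℝ (TangentSpace I y)) (A : Π y : N, TangentSpace I y)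
    (y : N) : Prop :=
  ∀ᶠ z in 𝓝 y, CMDiffAt ∞ (T% A) z ∧ A z ∈ D z

variable [Bundle.RiemannianBundle (fun y : N ↦ TangentSpace I y)]

/-- The orthogonal complement of a distribution. -/
def perp (D : Π y : N, Submodule ℝ (TangentSpace I y)) (y : N) :
    Submodule ℝ (TangentSpace I y) :=
  (D y)ᗮ

/-- `s` is a smooth orthonormal frame of `D` near `y`. -/
def IsOrthonormalFrameNear (D : Π y : N, Submodule ℝ (TangentSpace I y)) {k : ℕ}
    (s : Fin k → Π y : N, TangentSpace I y) (y : N) : Prop :=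
  (∀ i, IsSectionNear D (s i) y) ∧
    ∀ᶠ z in 𝓝 y, Orthonormal ℝ (fun i ↦ s i z) ∧
      Submodule.span ℝ (Set.range fun i ↦ s i z) = D z

/-- The component of a vector field on `D`. -/
def proj (D : Π y : N, Submodule ℝ (TangentSpace I y)) (A : Π y : N, TangentSpace I y) (y : N) :
    TangentSpace I y :=
  (D y).starProjection (A y)

variable [IsContMDiffRiemannianBundle I ∞ E (fun y : N ↦ TangentSpace I y)]

/-- The distribution `D` is totally geodesic on `O`: for local sections `U`, `V` of `D`, the
component of `∇_U V` on the orthogonal complement of `D` vanishes. -/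
def IsTotallyGeodesicOn (D : Π y : N, Submodule ℝ (TangentSpace I y)) (O : Set N) : Prop :=
  ∀ y ∈ O, ∀ U V : Π z : N, TangentSpace I z, IsSectionNear D U y → IsSectionNear D V y →
    proj (perp D) (nabla U V) y = 0

/-- The shape operator `S_V A`: minus the component of `∇_A V` on `D`. -/
def shape (D : Π y : N, Submodule ℝ (TangentSpace I y)) (V A : Π y : N, TangentSpace I y)
    (y : N) : TangentSpace I y :=
  - proj D (nabla A V) y

/-- The normal connection `∇^⊥_A V`: the component of `∇_A V` on the orthogonal complement
of `D`. -/
def normalConn (D : Π y : N, Submodule ℝ (TangentSpace I y)) (A V : Π y : N, TangentSpace I y)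
    (y : N) : TangentSpace I y :=
  proj (perp D) (nabla A V) y

/-- The curvature `R^⊥(U, V) W` of the normal connection. -/
def normalCurvature (D : Π y : N, Submodule ℝ (TangentSpace I y))
    (U V W : Π y : N, TangentSpace I y) (y : N) : TangentSpace I y :=
  normalConn D U (normalConn D V W) y - normalConn D V (normalConn D U W) y
    - normalConn D (VectorField.mlieBracket I U V) W y

end Distribution

section RiemannianMap

variable {E : Type*} [NormedAddCommGroup E] [NormedSpace ℝ E] [FiniteDimensional ℝ E]
  {H : Type*} [TopologicalSpace H] {I : ModelWithCorners ℝ E H}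
  {M : Type*} [TopologicalSpace M] [ChartedSpace H M] [IsManifold I ∞ M]
  {E' : Type*} [NormedAddCommGroup E'] [NormedSpace ℝ E'] [FiniteDimensional ℝ E']
  {H' : Type*} [TopologicalSpace H'] {J : ModelWithCorners ℝ E' H'}
  {N : Type*} [TopologicalSpace N] [ChartedSpace H' N] [IsManifold J ∞ N]

variable (I J) in
/-- The subspace `range F_*` at `p`. -/
def rangeDiff (F : M → N) (p : M) : Submodule ℝ (TangentSpace J (F p)) :=
  LinearMap.range (mfderiv I J F p).toLinearMap

/-- `A` is the image of `X` under `F_*` near `p`, that is, `A ∘ F = F_* X`. -/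
def IsPushforwardNear (F : M → N) (X : Π q : M, TangentSpace I q) (A : Π y : N, TangentSpace J y)
    (p : M) : Prop :=
  ∀ᶠ q in 𝓝 p, mfderiv I J F q (X q) = A (F q)

variable [Bundle.RiemannianBundle (fun q : M ↦ TangentSpace I q)]

variable (I J) in
/-- The horizontal distribution `(ker F_*)^⊥` on `M`. -/
def horizontal (F : M → N) (p : M) : Submodule ℝ (TangentSpace I p) :=
  (LinearMap.ker (mfderiv I J F p).toLinearMap)ᗮ

variable [Bundle.RiemannianBundle (fun y : N ↦ TangentSpace J y)]

variable (I J) in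
/-- `F` is a Riemannian map: it is smooth and its differential is isometric on the orthogonal
complement of its kernel. -/
def IsRiemannianMap (F : M → N) : Prop :=
  CMDiff ∞ F ∧ ∀ p : M, ∀ u ∈ horizontal I J F p, ∀ v ∈ horizontal I J F p,
    (inner ℝ (mfderiv I J F p u) (mfderiv I J F p v) : ℝ) = inner ℝ u v

variable (I J) in
/-- The adjoint `*F_* : T_{F p} N → T_p M` of the differential at `p`. -/
def adjointDiff (F : M → N) (p : M) : TangentSpace J (F p) →ₗ[ℝ] TangentSpace I p :=
  LinearMap.adjoint (mfderiv I J F p).toLinearMap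

variable [IsContMDiffRiemannianBundle I ∞ E (fun q : M ↦ TangentSpace I q)]
  [IsContMDiffRiemannianBundle J ∞ E' (fun y : N ↦ TangentSpace J y)]

variable (I) in
/-- `∇^{F⊥}_z V` at `p` for a tangent vector `z` of `M` at `p`: the component of
`∇_{F_* z} V` on the orthogonal complement of `D`. -/
def normalConnAlong (F : M → N) (D : Π y : N, Submodule ℝ (TangentSpace J y)) (p : M)
    (z : TangentSpace I p) (V : Π y : N, TangentSpace J y) : TangentSpace J (F p) :=
  (perp D (F p)).starProjection (leviCivita V (F p) (mfderiv I J F p z))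

/-- For `A = F_* X` and `B = F_* Y`, the covariant derivative of the shape operator at `p`,
`(∇_X S)_V F_* Y = F_* (∇_X (*F_* (S_V F_* Y))) - S_{∇^⊥_X V} F_* Y - S_V P ∇_X F_* Y`, where `P`
is the projection on `D`. -/
def covDerivShape (F : M → N) (D : Π y : N, Submodule ℝ (TangentSpace J y))
    (X : Π q : M, TangentSpace I q) (A V B : Π y : N, TangentSpace J y) (p : M) :
    TangentSpace J (F p) :=
  mfderiv I J F p (nabla X (fun q ↦ adjointDiff I J F q (shape D V B (F q))) p)
    - shape D (normalConn D A V) B (F p) - shape D V (proj D (nabla A B)) (F p)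

end RiemannianMap

end RiemGeom

end

/-! The Ricci tensor is a trace, and a trace may be computed in any orthonormal basis. At F(p) the
frames of D and of its orthogonal complement together form one (`IsFrameNear.sum_elim`), so each
Ricci value is a sum over D plus a sum over the complement. On pure pairs one of these sums is
already the partial Ricci tensor. What remains is to compute single components of the curvature from
the splitting ∇_A V = ∇^⊥_A V − S_V A; this is done in the lemmas `inner_curvature_...` by
Gauss–Codazzi type arguments.

Three facts carry these computations. Since the complement of D is totally geodesic, ∇_u for u in
the complement preserves sections of the complement, and by metric compatibility also sections of D
(`leviCivita_mem_perp`, `leviCivita_mem`); many terms vanish for this reason. Next, S_V is symmetric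
on D at F(p) (`leviCivita_symm`): D need not be integrable, but the bracket of pushed-forward fields
at F(p) is F_* of a bracket on M (`mfderiv_mlieBracket`) and so lies in the range. Finally, the
Koszul formulas of M and N agree on related horizontal fields (`inner_nabla`), so that F_* ∇^M_X
(*F_* C) has the same inner products with D at F(p) as ∇^N_{F_* X} C; this identifies the first term
of the covariant derivative of S.

The curvature on vectors is defined by chosen extensions, so it must be shown to be tensorial
(`curvatureAt_eq`). This needs the commutator formula for [V, W] (`mvfderiv_mlieBracket`) and the
smoothness of ∇_X Y. Hypotheses are stated as smoothness on a neighbourhood, since fields are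
differentiated repeatedly. -/

noncomputable section

namespace RiemGeom

/-! ### Functions and vector fields smooth near a point. -/

section Smooth

variable {E : Type*} [NormedAddCommGroup E] [NormedSpace ℝ E]
  {H : Type*} [TopologicalSpace H] {I : ModelWithCorners ℝ E H}
  {M : Type*} [TopologicalSpace M] [ChartedSpace H M]
  {G : Type*} [NormedAddCommGroup G] [NormedSpace ℝ G]

/-- The function `f` is smooth on a neighbourhood of `x`. -/
def SmoothFunNear (I : ModelWithCorners ℝ E H) (f : M → G) (x : M) : Prop :=
  ∀ᶠ z in 𝓝 x, CMDiffAt ∞ f z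

theorem SmoothFunNear.eventually {f : M → G} {x : M} (hf : SmoothFunNear I f x) :
    ∀ᶠ z in 𝓝 x, SmoothFunNear I f z := eventually_eventually_nhds.2 hf

theorem SmoothFunNear.contMDiffAt {f : M → G} {x : M} (hf : SmoothFunNear I f x) :
    CMDiffAt ∞ f x := hf.self_of_nhds

theorem SmoothFunNear.mdifferentiableAt {f : M → G} {x : M} (hf : SmoothFunNear I f x) :
    MDiffAt f x := hf.contMDiffAt.mdifferentiableAt (by simp)

theorem SmoothFunNear.congr {f g : M → G} {x : M} (hf : SmoothFunNear I f x)
    (h : ∀ᶠ z in 𝓝 x, g z = f z) : SmoothFunNear I g x := by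
  filter_upwards [hf, eventually_eventually_nhds.2 h] with z hz hz'
  exact hz.congr_of_eventuallyEq hz'

theorem SmoothFunNear.add {f g : M → G} {x : M} (hf : SmoothFunNear I f x)
    (hg : SmoothFunNear I g x) : SmoothFunNear I (fun z ↦ f z + g z) x := by
  filter_upwards [hf, hg] with z hz hz'
  exact hz.add hz'

theorem SmoothFunNear.sub {f g : M → G} {x : M} (hf : SmoothFunNear I f x)
    (hg : SmoothFunNear I g x) : SmoothFunNear I (fun z ↦ f z - g z) x := by
  filter_upwards [hf, hg] with z hz hz'
  exact hz.sub hz'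

theorem SmoothFunNear.const_mul {f : M → ℝ} {x : M} (c : ℝ) (hf : SmoothFunNear I f x) :
    SmoothFunNear I (fun z ↦ c * f z) x := by
  filter_upwards [hf] with z hz
  exact contMDiffAt_const.mul hz

variable [IsManifold I ∞ M]

variable (I) in
/-- The vector field `A` is smooth on a neighbourhood of `x`. -/
def SmoothNear (A : Π x : M, TangentSpace I x) (x : M) : Prop :=
  ∀ᶠ z in 𝓝 x, CMDiffAt ∞ (T% A) z

variable {A B : Π x : M, TangentSpace I x} {x : M}

theorem SmoothNear.eventually (hA : SmoothNear I A x) : ∀ᶠ z in 𝓝 x, SmoothNear I A z :=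
  eventually_eventually_nhds.2 hA

theorem SmoothNear.contMDiffAt (hA : SmoothNear I A x) : CMDiffAt ∞ (T% A) x :=
  hA.self_of_nhds

theorem SmoothNear.mdifferentiableAt (hA : SmoothNear I A x) : MDiffAt (T% A) x :=
  hA.contMDiffAt.mdifferentiableAt (by simp)

theorem SmoothNear.congr (hA : SmoothNear I A x) (h : ∀ᶠ z in 𝓝 x, B z = A z) :
    SmoothNear I B x := by
  filter_upwards [hA, eventually_eventually_nhds.2 h] with z hz hz'
  exact hz.congr_of_eventuallyEq (hz'.mono fun w hw ↦ by simp [hw])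

theorem SmoothNear.add (hA : SmoothNear I A x) (hB : SmoothNear I B x) :
    SmoothNear I (A + B) x := by
  filter_upwards [hA, hB] with z hz hz'
  exact hz.add_section hz'

theorem SmoothNear.sub (hA : SmoothNear I A x) (hB : SmoothNear I B x) :
    SmoothNear I (A - B) x := by
  filter_upwards [hA, hB] with z hz hz'
  exact hz.sub_section hz'

theorem SmoothNear.neg (hA : SmoothNear I A x) : SmoothNear I (-A) x := by
  filter_upwards [hA] with z hz
  exact hz.neg_section

theorem SmoothNear.smul {f : M → ℝ} (hf : SmoothFunNear I f x) (hA : SmoothNear I A x) :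
    SmoothNear I (f • A) x := by
  filter_upwards [hf, hA] with z hz hz'
  exact hz.smul_section hz'

theorem SmoothNear.sum {ι : Type*} {s : Finset ι} {A : ι → Π x : M, TangentSpace I x}
    (hA : ∀ i ∈ s, SmoothNear I (A i) x) : SmoothNear I (fun z ↦ ∑ i ∈ s, A i z) x := by
  filter_upwards [(Filter.eventually_all_finset s).2 hA] with z hz
  exact ContMDiffAt.sum_section hz

theorem SmoothNear.mlieBracket [CompleteSpace E] (hA : SmoothNear I A x) (hB : SmoothNear I B x) :
    SmoothNear I (VectorField.mlieBracket I A B) x := by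
  have : IsManifold I (((⊤ : ℕ∞) : ℕ∞ω) + 1) M := by simpa using ‹IsManifold I ∞ M›
  have : IsManifold I (minSmoothness ℝ 2) M := by
    simpa using IsManifold.of_le (I := I) (M := M) (m := 2) (n := ∞) (WithTop.coe_le_coe.2 le_top)
  filter_upwards [hA, hB] with z hz hz'
  exact ContMDiffAt.mlieBracket_vectorField (m := ⊤) (n := ⊤) hz hz' (by simp)

theorem smoothNear_extend [FiniteDimensional ℝ E] (v : TangentSpace I x) :
    SmoothNear I (FiberBundle.extend E (E := fun x : M ↦ TangentSpace I x) v) x := by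
  obtain ⟨s, hs, h⟩ := FiberBundle.exists_contMDiffOn_extend (k := ∞) I E (V := fun x : M ↦ TangentSpace I x) v
  filter_upwards [eventually_mem_nhds_iff.2 hs] with z hz
  exact h.contMDiffAt hz

/-- The derivative of a smooth function along a smooth vector field is smooth. -/
theorem SmoothFunNear.mvfderiv {f : M → G} (hf : SmoothFunNear I f x) (hA : SmoothNear I A x) :
    SmoothFunNear I (fun z ↦ mvfderiv I f z (A z)) x := by
  filter_upwards [hf.eventually, hA] with z hz hA
  obtain ⟨u, hu, huo, hzu⟩ := eventually_nhds_iff.1 hz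
  -- The derivative along `A` is the second component of the tangent map evaluated on `A`. On the
  -- open set `u` the tangent map within `u` is smooth and agrees with the unrestricted one.
  have h1 : ContMDiffOn I 𝓘(ℝ, G) ∞ f u := fun w hw ↦ (hu w hw).contMDiffWithinAt
  have h2 := h1.contMDiffOn_tangentMapWithin (m := ∞) (by simp) huo.uniqueMDiffOn
  have h3 : ContMDiffAt I (𝓘(ℝ, G).prod 𝓘(ℝ, G)) ∞
      (fun w ↦ tangentMapWithin I 𝓘(ℝ, G) f u (T% A w)) z := by
    refine ContMDiffAt.comp z (h2.contMDiffAt ?_) hA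
    exact (huo.preimage (FiberBundle.continuous_proj E _)).mem_nhds hzu
  have h4 := (contMDiff_snd_tangentBundle_modelSpace (n := ∞) G 𝓘(ℝ, G)).contMDiffAt.comp z h3
  refine h4.congr_of_eventuallyEq ?_
  filter_upwards [huo.mem_nhds hzu] with w hw
  change mfderiv I 𝓘(ℝ, G) f w (A w) = mfderivWithin I 𝓘(ℝ, G) f u w (A w)
  rw [mfderivWithin_of_isOpen huo hw]

end Smooth

/-! ### Lie brackets as commutators, and brackets of related fields. -/

section Bracket

variable {E : Type*} [NormedAddCommGroup E] [NormedSpace ℝ E]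
  {H : Type*} [TopologicalSpace H] {I : ModelWithCorners ℝ E H}
  {M : Type*} [TopologicalSpace M] [ChartedSpace H M] [IsManifold I ∞ M]
  {G : Type*} [NormedAddCommGroup G] [NormedSpace ℝ G]

-- The pullback of `V` applies the inverse of the derivative of the inverse chart, which the chain
-- rule cancels. This is the dictionary between derivatives in a chart and derivatives on the
-- manifold.
open VectorField Set in
theorem fderivWithin_comp_extChartAt_symm_apply {h : M → G} {x : M} {u : E}
    (hu : u ∈ (extChartAt I x).target) (hh : MDiffAt h ((extChartAt I x).symm u))
    (V : Π x : M, TangentSpace I x) :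
    fderivWithin ℝ (h ∘ (extChartAt I x).symm) (range I) u
        (mpullbackWithin 𝓘(ℝ, E) I (extChartAt I x).symm V (range I) u)
      = mvfderiv I h ((extChartAt I x).symm u) (V ((extChartAt I x).symm u)) := by
  have : IsManifold I 1 M := IsManifold.of_le (n := ∞) (WithTop.coe_le_coe.2 le_top)
  have hur : u ∈ range I := extChartAt_target_subset_range x hu
  have hs := mdifferentiableWithinAt_extChartAt_symm (I := I) hu
  have hc : mfderivWithin 𝓘(ℝ, E) 𝓘(ℝ, G) (h ∘ (extChartAt I x).symm) (range I) u
      = (mfderiv I 𝓘(ℝ, G) h ((extChartAt I x).symm u)).comp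
        (mfderivWithin 𝓘(ℝ, E) I (extChartAt I x).symm (range I) u) :=
    mfderiv_comp_mfderivWithin u hh hs (I.uniqueMDiffOn u hur)
  obtain ⟨e, he⟩ := isInvertible_mfderivWithin_extChartAt_symm (I := I) hu
  rw [← mfderivWithin_eq_fderivWithin]
  refine (congrFun (congrArg DFunLike.coe hc) _).trans ?_
  have hV : mfderivWithin 𝓘(ℝ, E) I (extChartAt I x).symm (range I) u
      (mpullbackWithin 𝓘(ℝ, E) I (extChartAt I x).symm V (range I) u)
        = V ((extChartAt I x).symm u) := by
    rw [mpullbackWithin_apply, ← he, ContinuousLinearMap.inverse_equiv]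
    exact e.apply_symm_apply _
  exact congrArg (mfderiv I 𝓘(ℝ, G) h ((extChartAt I x).symm u)) hV

open VectorField Set in
/-- The differentiation operator along `[V, W]` is the commutator of those along `V` and `W`. -/
theorem mvfderiv_mlieBracket [CompleteSpace E] {g : M → G} {x : M} (hg : SmoothFunNear I g x)
    {V W : Π x : M, TangentSpace I x} (hV : SmoothNear I V x) (hW : SmoothNear I W x) :
    mvfderiv I g x (mlieBracket I V W x)
      = mvfderiv I (fun y ↦ mvfderiv I g y (W y)) x (V x)
        - mvfderiv I (fun y ↦ mvfderiv I g y (V y)) x (W x) := by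
  have : IsManifold I 1 M := IsManifold.of_le (n := ∞) (WithTop.coe_le_coe.2 le_top)
  have : IsManifold I 2 M := IsManifold.of_le (n := ∞) (WithTop.coe_le_coe.2 le_top)
  set φ := extChartAt I x
  have hx0 : φ.symm (φ x) = x := extChartAt_to_inv x
  have hmem : φ x ∈ φ.target := mem_extChartAt_target x
  have hd : ∀ {A : Π x : M, TangentSpace I x}, SmoothNear I A x →
      DifferentiableWithinAt ℝ (mpullbackWithin 𝓘(ℝ, E) I φ.symm A (range I)) (range I) (φ x) := by
    intro A hA
    have := MDifferentiableWithinAt.differentiableWithinAt_mpullbackWithin_vectorField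
      (hA.mdifferentiableAt.mdifferentiableWithinAt (s := univ))
    rwa [preimage_univ, univ_inter] at this
  have hgc : ContDiffWithinAt ℝ ∞ (g ∘ φ.symm) (range I) (φ x) := by
    have := contMDiffAt_iff.1 hg.contMDiffAt
    simpa using! this.2
  -- In the model space the commutator formula is the symmetry of the second derivative. The rest of
  -- the proof transports its three terms to the manifold.
  have key := fderivWithin_apply_lieBracket hgc
    (by simpa using (WithTop.coe_le_coe.2 le_top : ((2 : ℕ∞) : ℕ∞ω) ≤ ∞)) I.uniqueDiffOn
    (I.range_subset_closure_interior (mem_range_self _)) (mem_range_self _) (hd hW) (hd hV)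
  have hev : ∀ {A : Π x : M, TangentSpace I x},
      (fun u ↦ fderivWithin ℝ (g ∘ φ.symm) (range I) u
        (mpullbackWithin 𝓘(ℝ, E) I φ.symm A (range I) u)) =ᶠ[𝓝[range I] (φ x)]
      (fun y ↦ mvfderiv I g y (A y)) ∘ φ.symm := by
    intro A
    have hcont : Filter.Tendsto φ.symm (𝓝[range I] (φ x)) (𝓝 x) := by
      have := (continuousAt_extChartAt_symm (I := I) x).tendsto
      rw [extChartAt_to_inv] at this
      exact this.mono_left nhdsWithin_le_nhds
    filter_upwards [extChartAt_target_mem_nhdsWithin (I := I) x,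
      hcont.eventually hg.eventually] with u hu hgu
    exact fderivWithin_comp_extChartAt_symm_apply hu hgu.mdifferentiableAt A
  have hD : ∀ {A B : Π x : M, TangentSpace I x}, SmoothNear I A x → SmoothNear I B x →
      fderivWithin ℝ (fun u ↦ fderivWithin ℝ (g ∘ φ.symm) (range I) u
        (mpullbackWithin 𝓘(ℝ, E) I φ.symm A (range I) u)) (range I) (φ x)
        (mpullbackWithin 𝓘(ℝ, E) I φ.symm B (range I) (φ x))
      = mvfderiv I (fun y ↦ mvfderiv I g y (A y)) x (B x) := by
    intro A B hA hB
    rw [hev.fderivWithin_eq_of_mem (mem_range_self _),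
      fderivWithin_comp_extChartAt_symm_apply hmem]
    · rw [hx0]
    · rw [hx0]
      exact (hg.mvfderiv hA).mdifferentiableAt
  rw [hD hW hV, hD hV hW] at key
  rw [← key]
  have hU := fderivWithin_comp_extChartAt_symm_apply (h := g) hmem
    (by rw [hx0]; exact hg.mdifferentiableAt) (mlieBracket I V W)
  rw [hx0] at hU
  rw [← hU]
  congr 1
  rw [mpullbackWithin_apply, hx0]
  -- The derivative of a chart at its own base point is the identity, so the pulled-back bracket at
  -- `φ x` is the bracket computed in the chart.
  have h1 := mfderivWithin_extChartAt_symm_inverse_apply (I := I) (mlieBracket I V W x)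
  refine h1.trans ?_
  rw [← mlieBracketWithin_univ, mlieBracketWithin_apply, preimage_univ, univ_inter,
    mfderiv_extChartAt_self]
  exact congrFun (congrArg DFunLike.coe (ContinuousLinearMap.inverse_id (R := ℝ) (M := E))) _

variable {E' : Type*} [NormedAddCommGroup E'] [NormedSpace ℝ E']
  {H' : Type*} [TopologicalSpace H'] {J : ModelWithCorners ℝ E' H'}
  {N : Type*} [TopologicalSpace N] [ChartedSpace H' N] [IsManifold J ∞ N]

theorem smoothFunNear_extChartAt (x : M) : SmoothFunNear I (extChartAt I x) x := by
  filter_upwards [(chartAt H x).open_source.mem_nhds (mem_chart_source H x)] with z hz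
  exact contMDiffAt_extChartAt' hz

omit [IsManifold I ∞ M] [IsManifold J ∞ N] in
theorem mvfderiv_comp_mfderiv {F : M → N} {f : N → G} {q : M} (hf : MDiffAt f (F q))
    (hF : MDiffAt F q) (v : TangentSpace I q) :
    mvfderiv I (f ∘ F) q v = mvfderiv J f (F q) (mfderiv I J F q v) :=
  mfderiv_comp_apply q hf hF v

omit [IsManifold I ∞ M] [IsManifold J ∞ N] in
theorem SmoothFunNear.comp {F : M → N} (hF : CMDiff ∞ F) {p : M} {f : N → G}
    (hf : SmoothFunNear J f (F p)) : SmoothFunNear I (f ∘ F) p := by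
  filter_upwards [hF.continuous.continuousAt.tendsto.eventually hf] with q hq
  exact hq.comp q hF.contMDiffAt

/-- The Lie bracket of related vector fields is related. -/
theorem mfderiv_mlieBracket [CompleteSpace E] [CompleteSpace E'] {F : M → N} (hF : CMDiff ∞ F)
    {p : M} {X Y : Π q : M, TangentSpace I q} {A B : Π y : N, TangentSpace J y}
    (hX : SmoothNear I X p) (hY : SmoothNear I Y p)
    (hA : SmoothNear J A (F p)) (hB : SmoothNear J B (F p))
    (hXA : IsPushforwardNear F X A p) (hYB : IsPushforwardNear F Y B p) :
    mfderiv I J F p (VectorField.mlieBracket I X Y p) = VectorField.mlieBracket J A B (F p) := by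
  have : IsManifold J 1 N := IsManifold.of_le (n := ∞) (WithTop.coe_le_coe.2 le_top)
  -- A chart, taken as a vector-valued function, has the identity as derivative at its base point.
  -- Hence this one test function determines a tangent vector at `F p`, and it suffices to compare
  -- the commutator formulas for `ψ ∘ F` and `ψ`.
  set ψ := extChartAt J (F p)
  have hψ : SmoothFunNear J ψ (F p) := smoothFunNear_extChartAt (F p)
  have hF' : ∀ q, MDiffAt F q := fun q ↦ hF.contMDiffAt.mdifferentiableAt (by simp)
  have hid : ∀ v : TangentSpace J (F p), mvfderiv J ψ (F p) v = v := fun v ↦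
    congrFun (congrArg DFunLike.coe (mfderiv_extChartAt_self (I := J) (x := F p))) v
  have hcomp : ∀ {Z : Π q : M, TangentSpace I q} {C : Π y : N, TangentSpace J y},
      IsPushforwardNear F Z C p → ∀ᶠ q in 𝓝 p,
        mvfderiv I (ψ ∘ F) q (Z q) = ((fun y ↦ mvfderiv J ψ y (C y)) ∘ F) q := by
    intro Z C hZC
    filter_upwards [hZC, hF.continuous.continuousAt.tendsto.eventually hψ.eventually] with q hq hq'
    rw [mvfderiv_comp_mfderiv hq'.mdifferentiableAt (hF' q), hq, Function.comp_apply]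
  have hcomp₂ : ∀ {Z T : Π q : M, TangentSpace I q} {C D : Π y : N, TangentSpace J y},
      SmoothNear J C (F p) → IsPushforwardNear F Z C p → IsPushforwardNear F T D p →
      mvfderiv I (fun q ↦ mvfderiv I (ψ ∘ F) q (Z q)) p (T p)
        = mvfderiv J (fun y ↦ mvfderiv J ψ y (C y)) (F p) (D (F p)) := by
    intro Z T C D hC hZC hTD
    have h1 : mvfderiv I (fun q ↦ mvfderiv I (ψ ∘ F) q (Z q)) p
        = mvfderiv I ((fun y ↦ mvfderiv J ψ y (C y)) ∘ F) p :=
      Filter.EventuallyEq.mfderiv_eq (hcomp hZC)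
    rw [h1, mvfderiv_comp_mfderiv (hψ.mvfderiv hC).mdifferentiableAt (hF' p), hTD.self_of_nhds]
  have hM := mvfderiv_mlieBracket (hψ.comp hF) hX hY
  have hN := mvfderiv_mlieBracket hψ hA hB
  rw [hcomp₂ hB hYB hXA, hcomp₂ hA hXA hYB, ← hN,
    mvfderiv_comp_mfderiv hψ.mdifferentiableAt (hF' p), hid, hid] at hM
  exact hM

end Bracket

/-! ### Expansions in orthonormal families. -/

section OrthonormalFamily

variable {V : Type*} [NormedAddCommGroup V] [InnerProductSpace ℝ V] {ι : Type*} [Fintype ι]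

theorem sum_inner_smul_of_mem_span {b : ι → V} (hb : Orthonormal ℝ b) {v : V}
    (hv : v ∈ Submodule.span ℝ (Set.range b)) : ∑ i, (inner ℝ (b i) v : ℝ) • b i = v := by
  classical
  induction hv using Submodule.span_induction with
  | mem x hx =>
    obtain ⟨j, rfl⟩ := hx
    simp [orthonormal_iff_ite.1 hb]
  | zero => simp
  | add x y _ _ hx hy => simp [inner_add_right, add_smul, Finset.sum_add_distrib, hx, hy]
  | smul c x _ hx => simp only [inner_smul_right, mul_smul, ← Finset.smul_sum, hx]

theorem starProjection_eq_sum {b : ι → V} (hb : Orthonormal ℝ b) {K : Submodule ℝ V}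
    [K.HasOrthogonalProjection] (hK : Submodule.span ℝ (Set.range b) = K) (v : V) :
    K.starProjection v = ∑ i, (inner ℝ (b i) v : ℝ) • b i := by
  have hbK : ∀ i, b i ∈ K := fun i ↦ hK ▸ Submodule.subset_span ⟨i, rfl⟩
  have hv : K.starProjection v ∈ Submodule.span ℝ (Set.range b) :=
    hK.symm ▸ K.starProjection_apply_mem v
  rw [← sum_inner_smul_of_mem_span hb hv]
  refine Finset.sum_congr rfl fun i _ ↦ ?_
  rw [← K.inner_starProjection_left_eq_right, K.starProjection_eq_self_iff.2 (hbK i)]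

end OrthonormalFamily

/-! ### Orthonormal frames, smoothness of ∇ and its calculus. -/

section Frame

variable {E : Type*} [NormedAddCommGroup E] [NormedSpace ℝ E] [FiniteDimensional ℝ E]
  {H : Type*} [TopologicalSpace H] {I : ModelWithCorners ℝ E H}
  {M : Type*} [TopologicalSpace M] [ChartedSpace H M] [IsManifold I ∞ M]
  [Bundle.RiemannianBundle (fun x : M ↦ TangentSpace I x)]

/-- `s` is a smooth orthonormal frame of `D` near `x`, with an arbitrary index type. -/
structure IsFrameNear {ι : Type*} (D : Π x : M, Submodule ℝ (TangentSpace I x))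
    (s : ι → Π x : M, TangentSpace I x) (x : M) : Prop where
  smooth : ∀ i, SmoothNear I (s i) x
  orthonormal : ∀ᶠ z in 𝓝 x, Orthonormal ℝ (fun i ↦ s i z)
  span : ∀ᶠ z in 𝓝 x, Submodule.span ℝ (Set.range fun i ↦ s i z) = D z

variable {ι : Type*} {D : Π x : M, Submodule ℝ (TangentSpace I x)}
  {s : ι → Π x : M, TangentSpace I x} {x : M} {A B C X Y Z : Π x : M, TangentSpace I x}

omit [FiniteDimensional ℝ E] in
theorem IsOrthonormalFrameNear.isFrameNear {k : ℕ} {s : Fin k → Π x : M, TangentSpace I x}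
    (h : IsOrthonormalFrameNear D s x) : IsFrameNear D s x where
  smooth i := (h.1 i).mono fun _ hz ↦ hz.1
  orthonormal := h.2.mono fun _ hz ↦ hz.1
  span := h.2.mono fun _ hz ↦ hz.2

omit [FiniteDimensional ℝ E] in
theorem IsFrameNear.eventually (h : IsFrameNear D s x) [Finite ι] :
    ∀ᶠ z in 𝓝 x, IsFrameNear D s z := by
  filter_upwards [Filter.eventually_all.2 fun i ↦ (h.smooth i).eventually,
    eventually_eventually_nhds.2 h.orthonormal, eventually_eventually_nhds.2 h.span]
    with z h1 h2 h3 using ⟨h1, h2, h3⟩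

variable [IsContMDiffRiemannianBundle I ∞ E (fun x : M ↦ TangentSpace I x)]

omit [FiniteDimensional ℝ E] in
theorem SmoothNear.inner (hA : SmoothNear I A x) (hB : SmoothNear I B x) :
    SmoothFunNear I (fun z ↦ (inner ℝ (A z) (B z) : ℝ)) x := by
  filter_upwards [hA, hB] with z hz hz'
  exact ContMDiffAt.inner_bundle (IB := I) (F := E) (E := fun x : M ↦ TangentSpace I x)
    (b := id) (v := A) (w := B) hz hz'

variable [Fintype ι]

theorem IsFrameNear.smoothNear_proj (h : IsFrameNear D s x) (hA : SmoothNear I A x) :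
    SmoothNear I (proj D A) x := by
  have : SmoothNear I (fun z ↦ ∑ i, ((fun z ↦ (inner ℝ (s i z) (A z) : ℝ)) • s i) z) x :=
    SmoothNear.sum fun i _ ↦ (h.smooth i).smul ((h.smooth i).inner hA)
  refine this.congr ?_
  filter_upwards [h.orthonormal, h.span] with z h1 h2
  exact starProjection_eq_sum h1 h2 _

-- Needed for ∇_X Y, which is defined pointwise by duality: only its inner products with smooth
-- fields, given by the Koszul formula, are visibly smooth.
omit [FiniteDimensional ℝ E]
  [IsContMDiffRiemannianBundle I ∞ E (fun x : M ↦ TangentSpace I x)] in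
theorem IsFrameNear.smoothNear_of_inner (h : IsFrameNear (fun _ ↦ ⊤) s x)
    (hA : ∀ i, SmoothFunNear I (fun z ↦ (inner ℝ (s i z) (A z) : ℝ)) x) : SmoothNear I A x := by
  have : SmoothNear I (fun z ↦ ∑ i, ((fun z ↦ (inner ℝ (s i z) (A z) : ℝ)) • s i) z) x :=
    SmoothNear.sum fun i _ ↦ (h.smooth i).smul (hA i)
  refine this.congr ?_
  filter_upwards [h.orthonormal, h.span] with z h1 h2
  exact (sum_inner_smul_of_mem_span h1 (h2.symm ▸ Submodule.mem_top)).symm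

omit [Fintype ι]

theorem SmoothNear.koszul (hX : SmoothNear I X x) (hY : SmoothNear I Y x)
    (hZ : SmoothNear I Z x) : SmoothFunNear I (koszul X Y Z) x :=
  ((((((hY.inner hZ).mvfderiv hX).add ((hZ.inner hX).mvfderiv hY)).sub
    ((hX.inner hY).mvfderiv hZ)).add ((hX.mlieBracket hY).inner hZ)).sub
    ((hX.mlieBracket hZ).inner hY)).sub ((hY.mlieBracket hZ).inner hX)

/-- The vector field `∇_X Y` is smooth. -/
theorem IsFrameNear.smoothNear_nabla [Fintype ι] (h : IsFrameNear (fun _ ↦ ⊤) s x)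
    (hX : SmoothNear I X x) (hY : SmoothNear I Y x) : SmoothNear I (nabla X Y) x := by
  refine h.smoothNear_of_inner fun i ↦
    ((hX.koszul hY (h.smooth i)).const_mul (1 / 2)).congr ?_
  filter_upwards [hX, hY, h.smooth i] with z h1 h2 h3
  rw [real_inner_comm]
  exact inner_leviCivita (h1.mdifferentiableAt (by simp)) (h2.mdifferentiableAt (by simp))
    (h3.mdifferentiableAt (by simp))

theorem leviCivita_add (hY : SmoothNear I Y x) (hZ : SmoothNear I Z x) :
    leviCivita (Y + Z) x = leviCivita Y x + leviCivita Z x :=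
  leviCivita.isCovariantDerivativeOnUniv.add hY.mdifferentiableAt hZ.mdifferentiableAt

theorem leviCivita_smul {f : M → ℝ} (hf : SmoothFunNear I f x) (hY : SmoothNear I Y x)
    (v : TangentSpace I x) :
    leviCivita (f • Y) x v = f x • leviCivita Y x v + mvfderiv I f x v • Y x := by
  rw [leviCivita.isCovariantDerivativeOnUniv.leibniz hY.mdifferentiableAt hf.mdifferentiableAt]
  simp

theorem leviCivita_congr (hY : SmoothNear I Y x) (h : ∀ᶠ z in 𝓝 x, Z z = Y z) :
    leviCivita Z x = leviCivita Y x :=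
  leviCivita.isCovariantDerivativeOnUniv.congr_of_eventuallyEq
    (hY.congr h).mdifferentiableAt hY.mdifferentiableAt Filter.univ_mem h

theorem leviCivita_neg (hY : SmoothNear I Y x) :
    leviCivita (-Y) x = - leviCivita Y x := by
  have := leviCivita.isCovariantDerivativeOnUniv.smul_const (-1 : ℝ) hY.mdifferentiableAt
  simpa using this

theorem leviCivita_sub (hY : SmoothNear I Y x) (hZ : SmoothNear I Z x) :
    leviCivita (Y - Z) x = leviCivita Y x - leviCivita Z x := by
  rw [sub_eq_add_neg, leviCivita_add hY hZ.neg, leviCivita_neg hZ, sub_eq_add_neg]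

/-- Compatibility of the Levi-Civita connection with the metric, along a tangent vector. -/
theorem mvfderiv_inner (hY : SmoothNear I Y x) (hZ : SmoothNear I Z x) (v : TangentSpace I x) :
    mvfderiv I (fun y ↦ (inner ℝ (Y y) (Z y) : ℝ)) x v
      = inner ℝ (leviCivita Y x v) (Z x) + inner ℝ (Y x) (leviCivita Z x v) := by
  have := leviCivita_metric (FiberBundle.mdifferentiableAt_extend I E
    (V := fun x : M ↦ TangentSpace I x) v) hY.mdifferentiableAt hZ.mdifferentiableAt
  simpa only [FiberBundle.extend_apply_self] using this

theorem mlieBracket_eq (hX : SmoothNear I X x) (hY : SmoothNear I Y x) :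
    VectorField.mlieBracket I X Y x = nabla X Y x - nabla Y X x :=
  (leviCivita_torsion hX.mdifferentiableAt hY.mdifferentiableAt).symm

end Frame

/-! ### Tensoriality of the curvature and its traces. -/

section CurvatureTensor

variable {E : Type*} [NormedAddCommGroup E] [NormedSpace ℝ E] [FiniteDimensional ℝ E]
  {H : Type*} [TopologicalSpace H] {I : ModelWithCorners ℝ E H}
  {M : Type*} [TopologicalSpace M] [ChartedSpace H M] [IsManifold I ∞ M]
  [Bundle.RiemannianBundle (fun x : M ↦ TangentSpace I x)]
  [IsContMDiffRiemannianBundle I ∞ E (fun x : M ↦ TangentSpace I x)]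
  {ι : Type*} [Fintype ι] {s : ι → Π x : M, TangentSpace I x} {x : M}
  {X X' Y Z Z' : Π x : M, TangentSpace I x}

omit [Fintype ι] in
theorem curvature_eq (X Y Z : Π x : M, TangentSpace I x) (x : M) :
    curvature X Y Z x = leviCivita (nabla Y Z) x (X x) - leviCivita (nabla X Z) x (Y x)
      - leviCivita Z x (VectorField.mlieBracket I X Y x) := rfl

omit [Fintype ι] in
theorem curvature_swap (X Y Z : Π x : M, TangentSpace I x) (x : M) :
    curvature X Y Z x = - curvature Y X Z x := by
  rw [curvature_eq, curvature_eq, VectorField.mlieBracket_swap_apply (V := X), map_neg]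
  abel

theorem curvature_add_left (h : IsFrameNear (fun _ ↦ ⊤) s x) (hX : SmoothNear I X x)
    (hX' : SmoothNear I X' x) (hZ : SmoothNear I Z x) :
    curvature (X + X') Y Z x = curvature X Y Z x + curvature X' Y Z x := by
  have h1 : nabla (X + X') Z = nabla X Z + nabla X' Z := by
    ext z; simp [nabla]
  rw [curvature_eq, h1, leviCivita_add (h.smoothNear_nabla hX hZ) (h.smoothNear_nabla hX' hZ),
    VectorField.mlieBracket_add_left hX.mdifferentiableAt hX'.mdifferentiableAt,
    curvature_eq, curvature_eq, Pi.add_apply, map_add, map_add, add_apply]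
  abel

theorem curvature_smul_left (h : IsFrameNear (fun _ ↦ ⊤) s x) {f : M → ℝ}
    (hf : SmoothFunNear I f x) (hX : SmoothNear I X x) (hZ : SmoothNear I Z x) :
    curvature (f • X) Y Z x = f x • curvature X Y Z x := by
  have h1 : nabla (f • X) Z = f • nabla X Z := by
    ext z; simp [nabla]
  rw [curvature_eq, h1, leviCivita_smul hf (h.smoothNear_nabla hX hZ),
    VectorField.mlieBracket_smul_left hf.mdifferentiableAt hX.mdifferentiableAt, curvature_eq,
    Pi.smul_apply', map_smul, map_add, map_smul, map_smul, nabla]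
  module

theorem curvature_add_right (h : IsFrameNear (fun _ ↦ ⊤) s x) (hX : SmoothNear I X x)
    (hY : SmoothNear I Y x) (hZ : SmoothNear I Z x) (hZ' : SmoothNear I Z' x) :
    curvature X Y (Z + Z') x = curvature X Y Z x + curvature X Y Z' x := by
  have h1 : ∀ {A : Π x : M, TangentSpace I x}, SmoothNear I A x →
      leviCivita (nabla A (Z + Z')) x = leviCivita (nabla A Z) x + leviCivita (nabla A Z') x := by
    intro A hA
    rw [← leviCivita_add (h.smoothNear_nabla hA hZ) (h.smoothNear_nabla hA hZ')]
    refine leviCivita_congr ((h.smoothNear_nabla hA hZ).add (h.smoothNear_nabla hA hZ')) ?_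
    filter_upwards [hZ.eventually, hZ'.eventually] with z hz hz'
    simp [nabla, leviCivita_add hz hz']
  have h2 : ∀ A : Π x : M, TangentSpace I x,
      nabla A (Z + Z') x = nabla A Z x + nabla A Z' x := by
    intro A
    simp [nabla, leviCivita_add hZ hZ']
  simp only [curvature, h2]
  simp only [nabla] at h1 ⊢
  rw [h1 hX, h1 hY]
  simp only [add_apply]
  abel

/-- Expanding ∇_X ∇_Y (fZ), the mixed first-order terms are symmetric in X and Y and cancel, while
XYf − YXf − [X, Y]f vanishes by `mvfderiv_mlieBracket`. -/
theorem curvature_smul_right (h : IsFrameNear (fun _ ↦ ⊤) s x) {f : M → ℝ}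
    (hf : SmoothFunNear I f x) (hX : SmoothNear I X x)
    (hY : SmoothNear I Y x) (hZ : SmoothNear I Z x) :
    curvature X Y (f • Z) x = f x • curvature X Y Z x := by
  have h1 : ∀ {A : Π x : M, TangentSpace I x}, SmoothNear I A x → ∀ v : TangentSpace I x,
      leviCivita (nabla A (f • Z)) x v = f x • leviCivita (nabla A Z) x v
        + mvfderiv I f x v • leviCivita Z x (A x) + mvfderiv I f x (A x) • leviCivita Z x v
        + mvfderiv I (fun y ↦ mvfderiv I f y (A y)) x v • Z x := by
    intro A hA v
    have hs1 := SmoothNear.smul hf (h.smoothNear_nabla hA hZ)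
    have hs2 := SmoothNear.smul (hf.mvfderiv hA) hZ
    rw [leviCivita_congr (hs1.add hs2), leviCivita_add hs1 hs2, add_apply,
      leviCivita_smul hf (h.smoothNear_nabla hA hZ), leviCivita_smul (hf.mvfderiv hA) hZ]
    · simp only [nabla]; abel
    filter_upwards [hf.eventually, hZ.eventually] with z hz hz'
    simp [nabla, leviCivita_smul hz hz']
  simp only [curvature]
  simp only [nabla] at h1 ⊢
  rw [h1 hX, h1 hY, leviCivita_smul hf hZ, mvfderiv_mlieBracket hf hX hY]
  module

omit [FiniteDimensional ℝ E] in
/-- An operation on smooth vector fields that is linear over the smooth functions depends only on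
the value of the vector field at the point. -/
theorem IsFrameNear.eq_of_linear {W : Type*} [AddCommGroup W] [Module ℝ W]
    (h : IsFrameNear (fun _ ↦ ⊤) s x) {Φ : (Π x : M, TangentSpace I x) → W}
    (hadd : ∀ {X Y}, SmoothNear I X x → SmoothNear I Y x → Φ (X + Y) = Φ X + Φ Y)
    (hsmul : ∀ {f : M → ℝ} {X}, SmoothFunNear I f x → SmoothNear I X x → Φ (f • X) = f x • Φ X)
    (hX : SmoothNear I X x) (hY : SmoothNear I Y x) (hXY : X x = Y x) : Φ X = Φ Y := by
  classical
  have hcongr : ∀ {X Y : Π x : M, TangentSpace I x}, SmoothNear I X x → SmoothNear I Y x →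
      (∀ᶠ z in 𝓝 x, X z = Y z) → Φ X = Φ Y := by
    intro X Y hX hY hXY
    -- This indicator function replaces a bump function: it is 1 near `x`, hence smooth there, and
    -- makes `ψ • X` and `ψ • Y` equal everywhere. No regularity away from `x` is needed.
    let ψ (z : M) : ℝ := if X z = Y z then 1 else 0
    have hψx : ψ x = 1 := by simp [ψ, hXY.self_of_nhds]
    have hψ : SmoothFunNear I ψ x :=
      SmoothFunNear.congr (f := fun _ ↦ (1 : ℝ)) (.of_forall fun z ↦ contMDiffAt_const)
        (hXY.mono fun z hz ↦ by simp [ψ, hz])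
    have heq : ψ • X = ψ • Y := by
      ext z
      by_cases hz : X z = Y z <;> simp [ψ, hz]
    have h1 := hsmul hψ hX
    have h2 := hsmul hψ hY
    rw [heq, h2] at h1
    simpa [hψx] using h1.symm
  have hzero : Φ 0 = 0 := by
    have h0 : SmoothNear I (0 : Π x : M, TangentSpace I x) x := by
      simpa using hX.sub hX
    have := hadd h0 h0
    simpa using this
  have hsum : ∀ (t : Finset ι) {c : ι → M → ℝ}, (∀ i, SmoothFunNear I (c i) x) →
      Φ (fun z ↦ ∑ i ∈ t, (c i • s i) z) = ∑ i ∈ t, c i x • Φ (s i) := by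
    intro t c hc
    induction t using Finset.induction_on with
    | empty => simp only [Finset.sum_empty]; exact hzero
    | insert a t ha ih =>
      simp only [Finset.sum_insert ha, ← ih, ← hsmul (hc a) (h.smooth a)]
      exact hadd ((h.smooth a).smul (hc a))
        (SmoothNear.sum fun i _ ↦ (h.smooth i).smul (hc i))
  -- Expanding in the frame leaves a formula that involves only the value of the field at `x`.
  have hexp : ∀ {X : Π x : M, TangentSpace I x}, SmoothNear I X x →
      Φ X = ∑ i, (inner ℝ (s i x) (X x) : ℝ) • Φ (s i) := by
    intro X hX
    rw [← hsum Finset.univ fun i ↦ (h.smooth i).inner hX]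
    refine hcongr hX (SmoothNear.sum fun i _ ↦ (h.smooth i).smul ((h.smooth i).inner hX)) ?_
    filter_upwards [h.orthonormal, h.span] with z h1 h2
    exact (sum_inner_smul_of_mem_span h1 (h2.symm ▸ Submodule.mem_top)).symm
  rw [hexp hX, hexp hY, hXY]

/-- The curvature tensor may be computed on arbitrary smooth vector fields. -/
theorem curvatureAt_eq (h : IsFrameNear (fun _ ↦ ⊤) s x) (hX : SmoothNear I X x)
    (hY : SmoothNear I Y x) (hZ : SmoothNear I Z x) :
    curvatureAt x (X x) (Y x) (Z x) = curvature X Y Z x := by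
  have eX := smoothNear_extend (X x)
  have eY := smoothNear_extend (Y x)
  have eZ := smoothNear_extend (Z x)
  unfold curvatureAt
  rw [h.eq_of_linear (Φ := fun A ↦ curvature A _ _ x) (curvature_add_left h · · eZ)
    (curvature_smul_left h · · eZ) eX hX (by simp)]
  -- Antisymmetry reduces the second argument to the first.
  rw [curvature_swap X, h.eq_of_linear (Φ := fun A ↦ curvature A _ _ x)
    (curvature_add_left h · · eZ) (curvature_smul_left h · · eZ) eY hY (by simp),
    ← curvature_swap X]
  exact h.eq_of_linear (Φ := fun A ↦ curvature _ _ A x) (curvature_add_right h hX hY · ·)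
    (curvature_smul_right h · hX hY ·) eZ hZ (by simp)

variable (x) in
/-- The curvature tensor as a linear map in its first argument. -/
def curvatureMap (h : IsFrameNear (fun _ ↦ ⊤) s x) (v w : TangentSpace I x) :
    TangentSpace I x →ₗ[ℝ] TangentSpace I x where
  toFun u := curvatureAt x u v w
  map_add' u u' := by
    have := curvatureAt_eq h ((smoothNear_extend u).add (smoothNear_extend u'))
      (smoothNear_extend v) (smoothNear_extend w)
    rw [curvature_add_left h (smoothNear_extend u) (smoothNear_extend u')
      (smoothNear_extend w)] at this
    simp only [Pi.add_apply, FiberBundle.extend_apply_self] at this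
    exact this
  map_smul' c u := by
    have hc : SmoothFunNear I (fun _ : M ↦ c) x := .of_forall fun z ↦ contMDiffAt_const
    have := curvatureAt_eq h ((smoothNear_extend u).smul hc) (smoothNear_extend v)
      (smoothNear_extend w)
    rw [curvature_smul_left h hc (smoothNear_extend u) (smoothNear_extend w)] at this
    simp only [Pi.smul_apply', FiberBundle.extend_apply_self] at this
    exact this

theorem curvatureMap_apply (h : IsFrameNear (fun _ ↦ ⊤) s x) (u v w : TangentSpace I x) :
    curvatureMap x h v w u = curvatureAt x u v w := rfl

/-- Both sides are the trace of `curvatureMap`, in two orthonormal bases. -/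
theorem ricci_eq_sum (h : IsFrameNear (fun _ ↦ ⊤) s x) (u v : TangentSpace I x) :
    ricci x u v = ∑ i, (inner ℝ (curvatureAt x (s i x) u v) (s i x) : ℝ) := by
  let b := OrthonormalBasis.mk h.orthonormal.self_of_nhds h.span.self_of_nhds.ge
  have h1 := (curvatureMap x h u v).trace_eq_sum_inner (stdOrthonormalBasis ℝ _)
  have h2 := (curvatureMap x h u v).trace_eq_sum_inner b
  rw [h1] at h2
  simpa [ricci, curvatureMap_apply, b, real_inner_comm] using h2

/-- Both sides are the trace of the compression of `curvatureMap` to `D x`, in two orthonormal bases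
of that subspace. -/
theorem partialRicci_eq_sum {κ : Type*} [Fintype κ] {D : Π x : M, Submodule ℝ (TangentSpace I x)}
    {t : κ → Π x : M, TangentSpace I x} (h : IsFrameNear (fun _ ↦ ⊤) s x)
    (ht : IsFrameNear D t x) (u v : TangentSpace I x) :
    partialRicci (D x) u v = ∑ i, (inner ℝ (curvatureAt x (t i x) u v) (t i x) : ℝ) := by
  have hspan := ht.span.self_of_nhds
  have htD : ∀ i, t i x ∈ D x := fun i ↦ hspan ▸ Submodule.subset_span ⟨i, rfl⟩
  let T : D x →ₗ[ℝ] D x :=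
    (D x).orthogonalProjectionOnto.toLinearMap ∘ₗ curvatureMap x h u v ∘ₗ (D x).subtype
  have hon : Orthonormal ℝ (fun i ↦ (⟨t i x, htD i⟩ : D x)) := by
    have := ht.orthonormal.self_of_nhds
    exact ⟨fun i ↦ this.1 i, fun i j hij ↦ this.2 hij⟩
  let b : OrthonormalBasis κ ℝ (D x) := OrthonormalBasis.mk hon (by
    intro w _
    have hw := sum_inner_smul_of_mem_span (v := (w : TangentSpace I x))
      ht.orthonormal.self_of_nhds (by rw [hspan]; exact w.2)
    have : w = ∑ i, (inner ℝ (t i x) (w : TangentSpace I x) : ℝ) • (⟨t i x, htD i⟩ : D x) := by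
      ext
      simp [hw]
    rw [this]
    exact Submodule.sum_mem _ fun i _ ↦ Submodule.smul_mem _ _ (Submodule.subset_span ⟨i, rfl⟩))
  have h1 := T.trace_eq_sum_inner (stdOrthonormalBasis ℝ _)
  have h2 := T.trace_eq_sum_inner b
  rw [h1] at h2
  simpa [partialRicci, T, curvatureMap_apply, b, real_inner_comm] using h2

end CurvatureTensor

/-! ### Curvature components for a splitting with totally geodesic complement. -/

section Splitting

variable {E : Type*} [NormedAddCommGroup E] [NormedSpace ℝ E] [FiniteDimensional ℝ E]
  {H : Type*} [TopologicalSpace H] {I : ModelWithCorners ℝ E H}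
  {N : Type*} [TopologicalSpace N] [ChartedSpace H N] [IsManifold I ∞ N]

section Section

variable {D : Π y : N, Submodule ℝ (TangentSpace I y)} {A B : Π y : N, TangentSpace I y} {y : N}

omit [FiniteDimensional ℝ E] in
theorem isSectionNear_iff :
    IsSectionNear D A y ↔ SmoothNear I A y ∧ ∀ᶠ z in 𝓝 y, A z ∈ D z :=
  Filter.eventually_and

omit [FiniteDimensional ℝ E] in
theorem IsSectionNear.smoothNear (h : IsSectionNear D A y) : SmoothNear I A y :=
  (isSectionNear_iff.1 h).1

omit [FiniteDimensional ℝ E] in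
theorem IsSectionNear.eventually_mem (h : IsSectionNear D A y) : ∀ᶠ z in 𝓝 y, A z ∈ D z :=
  (isSectionNear_iff.1 h).2

omit [FiniteDimensional ℝ E] in
theorem IsSectionNear.mem (h : IsSectionNear D A y) : A y ∈ D y :=
  h.eventually_mem.self_of_nhds

omit [FiniteDimensional ℝ E] in
theorem IsSectionNear.eventually (h : IsSectionNear D A y) :
    ∀ᶠ z in 𝓝 y, IsSectionNear D A z :=
  eventually_eventually_nhds.2 h

end Section

variable [Bundle.RiemannianBundle (fun y : N ↦ TangentSpace I y)]
  {D : Π y : N, Submodule ℝ (TangentSpace I y)} {y : N}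
  {ι κ : Type*} {d : ι → Π y : N, TangentSpace I y} {e : κ → Π y : N, TangentSpace I y}
  {A B C U V W : Π y : N, TangentSpace I y}

theorem IsFrameNear.sum_elim (hd : IsFrameNear D d y) (he : IsFrameNear (perp D) e y) :
    IsFrameNear (fun _ ↦ ⊤) (Sum.elim d e) y where
  smooth := by
    rintro (i | k)
    exacts [hd.smooth i, he.smooth k]
  orthonormal := by
    filter_upwards [hd.orthonormal, hd.span, he.orthonormal, he.span] with z h1 h2 h3 h4
    have hmem : ∀ i, d i z ∈ D z := fun i ↦ h2 ▸ Submodule.subset_span ⟨i, rfl⟩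
    have hmem' : ∀ k, e k z ∈ (D z)ᗮ := fun k ↦ by
      have : e k z ∈ perp D z := h4 ▸ Submodule.subset_span ⟨k, rfl⟩
      exact this
    refine ⟨?_, ?_⟩
    · rintro (i | k)
      exacts [h1.1 i, h3.1 k]
    · rintro (i | k) (j | l) hij
      · exact h1.2 fun h ↦ hij (h ▸ rfl)
      · exact Submodule.inner_right_of_mem_orthogonal (hmem i) (hmem' l)
      · exact Submodule.inner_left_of_mem_orthogonal (hmem j) (hmem' k)
      · exact h3.2 fun h ↦ hij (h ▸ rfl)
  span := by
    filter_upwards [hd.span, he.span] with z h2 h4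
    have : (Set.range fun i ↦ Sum.elim d e i z)
        = (Set.range fun i ↦ d i z) ∪ Set.range fun k ↦ e k z := by
      ext v
      simp
    rw [this, Submodule.span_union, h2, h4]
    exact Submodule.sup_orthogonal_of_hasOrthogonalProjection

omit [IsManifold I ∞ N] in
theorem perp_perp (D : Π y : N, Submodule ℝ (TangentSpace I y)) : perp (perp D) = D :=
  funext fun z ↦ (D z).orthogonal_orthogonal

omit [IsManifold I ∞ N] in
theorem proj_mem (D : Π y : N, Submodule ℝ (TangentSpace I y)) (A : Π y : N, TangentSpace I y)
    (y : N) : proj D A y ∈ D y :=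
  (D y).starProjection_apply_mem _

omit [IsManifold I ∞ N] in
theorem inner_proj_left {v : TangentSpace I y} (hv : v ∈ D y) (A : Π y : N, TangentSpace I y) :
    (inner ℝ (proj D A y) v : ℝ) = inner ℝ (A y) v := by
  rw [proj, (D y).inner_starProjection_left_eq_right, (D y).starProjection_eq_self_iff.2 hv]

omit [IsManifold I ∞ N] in
theorem proj_eq_self (h : A y ∈ D y) : proj D A y = A y :=
  (D y).starProjection_eq_self_iff.2 h

variable [IsContMDiffRiemannianBundle I ∞ E (fun y : N ↦ TangentSpace I y)]

theorem nabla_eq_normalConn_sub_shape (D : Π y : N, Submodule ℝ (TangentSpace I y))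
    (A V : Π y : N, TangentSpace I y) : nabla A V = normalConn D A V - shape D V A := by
  ext z
  have := (D z).starProjection_add_starProjection_orthogonal (nabla A V z)
  simp only [normalConn, shape, proj, perp, Pi.sub_apply, sub_neg_eq_add]
  rw [add_comm]
  exact this.symm

theorem inner_shape_left {v : TangentSpace I y} (hv : v ∈ D y) (V A : Π y : N, TangentSpace I y) :
    (inner ℝ (shape D V A y) v : ℝ) = - inner ℝ (leviCivita V y (A y)) v := by
  rw [shape, inner_neg_left, inner_proj_left hv]
  rfl

theorem shape_mem (D : Π y : N, Submodule ℝ (TangentSpace I y))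
    (V A : Π y : N, TangentSpace I y) (y : N) : shape D V A y ∈ D y :=
  (D y).neg_mem (proj_mem _ _ _)

theorem normalConn_mem (D : Π y : N, Submodule ℝ (TangentSpace I y))
    (A V : Π y : N, TangentSpace I y) (y : N) : normalConn D A V y ∈ perp D y :=
  proj_mem _ _ _

theorem inner_normalConn_left {v : TangentSpace I y} (hv : v ∈ perp D y)
    (A V : Π y : N, TangentSpace I y) :
    (inner ℝ (normalConn D A V y) v : ℝ) = inner ℝ (leviCivita V y (A y)) v :=
  inner_proj_left hv _

omit [FiniteDimensional ℝ E] [IsManifold I ∞ N]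
  [IsContMDiffRiemannianBundle I ∞ E (fun y : N ↦ TangentSpace I y)] in
theorem inner_eq_zero_of_mem_perp {v w : TangentSpace I y} (hv : v ∈ D y) (hw : w ∈ perp D y) :
    (inner ℝ v w : ℝ) = 0 :=
  Submodule.inner_right_of_mem_orthogonal hv hw

/-- Differentiate ⟨A, V⟩ = 0, which holds on a neighbourhood. -/
theorem inner_leviCivita_perp (hA : IsSectionNear D A y) (hV : IsSectionNear (perp D) V y)
    (v : TangentSpace I y) :
    (inner ℝ (leviCivita A y v) (V y) : ℝ) = - inner ℝ (A y) (leviCivita V y v) := by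
  have h0 : mvfderiv I (fun z ↦ (inner ℝ (A z) (V z) : ℝ)) y = mvfderiv I (fun _ ↦ (0 : ℝ)) y := by
    refine Filter.EventuallyEq.mfderiv_eq ?_
    filter_upwards [hA.eventually_mem, hV.eventually_mem] with z h1 h2
    exact inner_eq_zero_of_mem_perp h1 h2
  have := mvfderiv_inner hA.smoothNear hV.smoothNear v
  rw [h0, mvfderiv_const, zero_apply] at this
  linarith

theorem mlieBracket_eq_shape (hU : SmoothNear I U y) (hA : SmoothNear I A y) :
    VectorField.mlieBracket I U A y
      = nabla U A y - normalConn D A U y + shape D U A y := by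
  rw [mlieBracket_eq hU hA, nabla_eq_normalConn_sub_shape D A U, Pi.sub_apply]
  abel

/-- `d` and `e` are orthonormal frames near `y` of `D` and of its orthogonal complement, and the
latter is totally geodesic. -/
structure IsGeodesicSplitting (D : Π y : N, Submodule ℝ (TangentSpace I y))
    (d : ι → Π y : N, TangentSpace I y) (e : κ → Π y : N, TangentSpace I y) (y : N) : Prop where
  frame : IsFrameNear D d y
  frame_perp : IsFrameNear (perp D) e y
  geodesic : ∀ᶠ z in 𝓝 y, ∀ U V : Π z : N, TangentSpace I z, IsSectionNear (perp D) U z →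
    IsSectionNear (perp D) V z → nabla U V z ∈ perp D z

theorem IsTotallyGeodesicOn.isGeodesicSplitting {O : Set N} (hO : IsOpen O)
    (h : IsTotallyGeodesicOn (perp D) O) (hy : y ∈ O) (hd : IsFrameNear D d y)
    (he : IsFrameNear (perp D) e y) : IsGeodesicSplitting D d e y where
  frame := hd
  frame_perp := he
  geodesic := by
    filter_upwards [hO.mem_nhds hy] with z hz U V hU hV
    have := h z hz U V hU hV
    exact (Submodule.starProjection_apply_eq_zero_iff _).1 (by rwa [perp_perp] at this)

namespace IsGeodesicSplitting

variable [Fintype ι] [Fintype κ] (h : IsGeodesicSplitting D d e y)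
include h

omit [Fintype ι] [Fintype κ] in
theorem full : IsFrameNear (fun _ ↦ ⊤) (Sum.elim d e) y := h.frame.sum_elim h.frame_perp

theorem eventually : ∀ᶠ z in 𝓝 y, IsGeodesicSplitting D d e z := by
  filter_upwards [h.frame.eventually, h.frame_perp.eventually,
    eventually_eventually_nhds.2 h.geodesic] with z h1 h2 h3 using ⟨h1, h2, h3⟩

theorem isSectionNear_normalConn (hA : SmoothNear I A y) (hV : SmoothNear I V y) :
    IsSectionNear (perp D) (normalConn D A V) y :=
  isSectionNear_iff.2 ⟨h.frame_perp.smoothNear_proj (h.full.smoothNear_nabla hA hV),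
    .of_forall (normalConn_mem D A V)⟩

theorem isSectionNear_shape (hA : SmoothNear I A y) (hV : SmoothNear I V y) :
    IsSectionNear D (shape D V A) y :=
  isSectionNear_iff.2 ⟨(h.frame.smoothNear_proj (h.full.smoothNear_nabla hA hV)).neg,
    .of_forall (shape_mem D V A)⟩

omit [Fintype ι] in
theorem exists_isSectionNear_perp {u : TangentSpace I y} (hu : u ∈ perp D y) :
    ∃ U, IsSectionNear (perp D) U y ∧ U y = u := by
  refine ⟨proj (perp D) (FiberBundle.extend E u), isSectionNear_iff.2
    ⟨h.frame_perp.smoothNear_proj (smoothNear_extend u), .of_forall (proj_mem _ _)⟩, ?_⟩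
  rw [proj_eq_self] <;> simp [hu]

-- Total geodesy is assumed for fields; a single vector `u` is first extended to a section by
-- projecting any smooth extension.
omit [Fintype ι] in
theorem leviCivita_mem_perp (hV : IsSectionNear (perp D) V y) {u : TangentSpace I y}
    (hu : u ∈ perp D y) : leviCivita V y u ∈ perp D y := by
  obtain ⟨U, hU, rfl⟩ := h.exists_isSectionNear_perp hu
  exact h.geodesic.self_of_nhds U V hU hV

-- Dual to `leviCivita_mem_perp`: ⟨∇_u A, V⟩ = −⟨A, ∇_u V⟩ = 0.
omit [Fintype ι] in
theorem leviCivita_mem (hA : IsSectionNear D A y) {u : TangentSpace I y}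
    (hu : u ∈ perp D y) : leviCivita A y u ∈ D y := by
  rw [← (D y).orthogonal_orthogonal, Submodule.mem_orthogonal']
  intro v hv
  obtain ⟨V, hV, rfl⟩ := h.exists_isSectionNear_perp hv
  rw [inner_leviCivita_perp hA hV,
    inner_eq_zero_of_mem_perp hA.mem (h.leviCivita_mem_perp hV hu), neg_zero]

theorem isSectionNear_nabla (hU : IsSectionNear (perp D) U y) (hA : IsSectionNear D A y) :
    IsSectionNear D (nabla U A) y := by
  refine isSectionNear_iff.2 ⟨h.full.smoothNear_nabla hU.smoothNear hA.smoothNear, ?_⟩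
  filter_upwards [h.eventually, hU.eventually, hA.eventually] with z h1 h2 h3
  exact h1.leviCivita_mem h3 h2.mem

/-- Equality on a neighbourhood, and not only at `y`, is what allows differentiating once more. -/
theorem nabla_eventuallyEq (hU : IsSectionNear (perp D) U y) (hV : IsSectionNear (perp D) V y) :
    ∀ᶠ z in 𝓝 y, nabla U V z = normalConn D U V z := by
  filter_upwards [h.eventually, hU.eventually, hV.eventually] with z h1 h2 h3
  exact (proj_eq_self (D := perp D) (A := nabla U V) (h1.leviCivita_mem_perp h3 h2.mem)).symm

theorem leviCivita_nabla (hU : IsSectionNear (perp D) U y) (hV : IsSectionNear (perp D) V y) :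
    leviCivita (nabla U V) y = leviCivita (normalConn D U V) y :=
  leviCivita_congr (h.isSectionNear_normalConn hU.smoothNear hV.smoothNear).smoothNear
    (h.nabla_eventuallyEq hU hV)

theorem leviCivita_nabla_eq_sub (hA : SmoothNear I A y) (hV : SmoothNear I V y) :
    leviCivita (nabla A V) y
      = leviCivita (normalConn D A V) y - leviCivita (shape D V A) y := by
  rw [nabla_eq_normalConn_sub_shape D A V, leviCivita_sub
    (h.isSectionNear_normalConn hA hV).smoothNear (h.isSectionNear_shape hA hV).smoothNear]

/-- Differentiating ⟨∇_A B, U⟩ = ⟨S_U A, B⟩ along U gives the first curvature term. Its summand ⟨S_U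
A, ∇_U B⟩ cancels against ⟨∇_A ∇_U B, U⟩, as ∇_U B is in D. The bracket [U, A] = ∇_U A − ∇^⊥_A U +
S_U A yields the last two terms; only there is the symmetry of S_U needed. -/
theorem inner_curvature_perp_range (hA : IsSectionNear D A y) (hB : IsSectionNear D B y)
    (hU : IsSectionNear (perp D) U y)
    (hsym : ∀ u ∈ D y, ∀ v ∈ D y,
      (inner ℝ (leviCivita U y u) v : ℝ) = inner ℝ u (leviCivita U y v)) :
    (inner ℝ (curvature U A B y) (U y) : ℝ) =
      -(inner ℝ (shape D (normalConn D U U) A y) (B y)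
        - inner ℝ (nabla U (shape D U A) y) (B y)
        + inner ℝ (shape D U A y) (shape D U B y)
        + inner ℝ (nabla U A y) (shape D U B y)) := by
  have sA := hA.smoothNear
  have sB := hB.smoothNear
  have sU := hU.smoothNear
  have hS := h.isSectionNear_shape sA sU
  have hW := h.isSectionNear_normalConn sU sU
  have hUA := h.isSectionNear_nabla hU hA
  have hUB := h.isSectionNear_nabla hU hB
  have hfun : mvfderiv I (fun z ↦ (inner ℝ (nabla A B z) (U z) : ℝ)) y
      = mvfderiv I (fun z ↦ (inner ℝ (shape D U A z) (B z) : ℝ)) y := by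
    refine Filter.EventuallyEq.mfderiv_eq ?_
    filter_upwards [hB.eventually, hU.eventually] with z h2 h3
    rw [nabla, inner_leviCivita_perp h2 h3, inner_shape_left h2.mem, real_inner_comm]
  have t1 := mvfderiv_inner (h.full.smoothNear_nabla sA sB) sU (U y)
  rw [hfun, mvfderiv_inner hS.smoothNear sB] at t1
  have t1' : (inner ℝ (nabla A B y) (leviCivita U y (U y)) : ℝ)
      = inner ℝ (shape D (normalConn D U U) A y) (B y) := by
    rw [show leviCivita U y (U y) = normalConn D U U y from
      (h.nabla_eventuallyEq hU hU).self_of_nhds, nabla, inner_leviCivita_perp hB hW,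
      inner_shape_left hB.mem, real_inner_comm]
  have t2 : (inner ℝ (leviCivita (nabla U B) y (A y)) (U y) : ℝ)
      = inner ℝ (shape D U A y) (leviCivita B y (U y)) := by
    rw [inner_leviCivita_perp hUB hU, real_inner_comm, ← inner_shape_left hUB.mem U A]
    rfl
  have hs : ∀ u ∈ D y, (inner ℝ (B y) (leviCivita U y u) : ℝ) = - inner ℝ u (shape D U B y) := by
    intro u hu
    rw [real_inner_comm, hsym u hu _ hB.mem, real_inner_comm, ← neg_eq_iff_eq_neg,
      ← inner_shape_left hu U B, real_inner_comm]
  have t3 : (inner ℝ (leviCivita B y (VectorField.mlieBracket I U A y)) (U y) : ℝ)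
      = inner ℝ (nabla U A y) (shape D U B y) + inner ℝ (shape D U A y) (shape D U B y) := by
    rw [inner_leviCivita_perp hB hU, mlieBracket_eq_shape (D := D) sU sA, map_add, map_sub,
      inner_add_right, inner_sub_right, hs _ hUA.mem, hs _ hS.mem, inner_eq_zero_of_mem_perp hB.mem
        (h.leviCivita_mem_perp hU (normalConn_mem D A U y))]
    ring
  rw [curvature_eq, inner_sub_left, inner_sub_left, t2, t3]
  rw [t1'] at t1
  simp only [nabla] at t1 ⊢
  linarith

/-- The factor 2 has two sources: ⟨S_W A, ∇_V A⟩ arises once from the product rule for V⟨S_W A, A⟩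
and once from the part ∇_V A of the bracket. -/
theorem inner_curvature_range_perp (hA : IsSectionNear D A y) (hV : IsSectionNear (perp D) V y)
    (hW : IsSectionNear (perp D) W y)
    (hsym : ∀ u ∈ D y, ∀ v ∈ D y,
      (inner ℝ (leviCivita W y u) v : ℝ) = inner ℝ u (leviCivita W y v)) :
    (inner ℝ (curvature A V W y) (A y) : ℝ) =
      -(inner ℝ (shape D (normalConn D V W) A y) (A y)
        + inner ℝ (shape D V A y) (shape D W A y)
        - mvfderiv I (fun z ↦ inner ℝ (shape D W A z) (A z)) y (V y)
        + 2 * inner ℝ (shape D W A y) (nabla V A y)) := by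
  have sA := hA.smoothNear
  have sV := hV.smoothNear
  have sW := hW.smoothNear
  have hS := h.isSectionNear_shape sA sW
  have hVA := h.isSectionNear_nabla hV hA
  have t1 : (inner ℝ (leviCivita (nabla V W) y (A y)) (A y) : ℝ)
      = - inner ℝ (shape D (normalConn D V W) A y) (A y) := by
    rw [h.leviCivita_nabla hV hW, inner_shape_left hA.mem, neg_neg]
  have t2 : (inner ℝ (leviCivita (nabla A W) y (V y)) (A y) : ℝ)
      = - inner ℝ (leviCivita (shape D W A) y (V y)) (A y) := by
    rw [h.leviCivita_nabla_eq_sub sA sW, sub_apply, inner_sub_left, real_inner_comm,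
      inner_eq_zero_of_mem_perp hA.mem
        (h.leviCivita_mem_perp (h.isSectionNear_normalConn sA sW) hV.mem), zero_sub]
  have t2' := mvfderiv_inner hS.smoothNear sA (V y)
  have hs : ∀ u ∈ D y, (inner ℝ (A y) (leviCivita W y u) : ℝ) = - inner ℝ (shape D W A y) u := by
    intro u hu
    rw [real_inner_comm, hsym u hu _ hA.mem, inner_shape_left hu, neg_neg, real_inner_comm]
  have t3 : (inner ℝ (leviCivita W y (VectorField.mlieBracket I A V y)) (A y) : ℝ)
      = inner ℝ (shape D V A y) (shape D W A y) + inner ℝ (shape D W A y) (nabla V A y) := by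
    rw [real_inner_comm, VectorField.mlieBracket_swap_apply, mlieBracket_eq_shape (D := D) sV sA, map_neg,
      map_add, map_sub, inner_neg_right, inner_add_right, inner_sub_right, hs _ hVA.mem,
      hs _ (shape_mem D V A y), inner_eq_zero_of_mem_perp hA.mem
        (h.leviCivita_mem_perp hW (normalConn_mem D A V y)), real_inner_comm (shape D W A y)]
    ring
  rw [curvature_eq, inner_sub_left, inner_sub_left, t1, t2, t3]
  simp only [nabla] at t2' ⊢
  linarith

/-- Inside the complement the inner derivatives already agree with ∇^⊥, and pairing with U projects
the outer ones. -/
theorem inner_curvature_perp (hU : IsSectionNear (perp D) U y) (hV : IsSectionNear (perp D) V y)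
    (hW : IsSectionNear (perp D) W y) :
    (inner ℝ (curvature U V W y) (U y) : ℝ) = inner ℝ (normalCurvature D U V W y) (U y) := by
  rw [curvature_eq, normalCurvature, inner_sub_left, inner_sub_left, inner_sub_left, inner_sub_left,
    inner_normalConn_left hU.mem, inner_normalConn_left hU.mem, inner_normalConn_left hU.mem,
    h.leviCivita_nabla hV hW, h.leviCivita_nabla hU hW]

/-- A Codazzi equation. As [B, A] lies in D at y, it equals P∇_B A − P∇_A B there, which supplies
the correction terms of the two covariant derivatives of S. -/
theorem inner_curvature_mixed_range (hA : IsSectionNear D A y) (hB : IsSectionNear D B y)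
    (hV : IsSectionNear (perp D) V y) (hAB : VectorField.mlieBracket I B A y ∈ D y) :
    (inner ℝ (curvature B A V y) (B y) : ℝ) =
      (inner ℝ (nabla A (shape D V B) y) (B y) - inner ℝ (shape D (normalConn D A V) B y) (B y)
        - inner ℝ (shape D V (proj D (nabla A B)) y) (B y))
      - (inner ℝ (nabla B (shape D V A) y) (B y) - inner ℝ (shape D (normalConn D B V) A y) (B y)
        - inner ℝ (shape D V (proj D (nabla B A)) y) (B y)) := by
  have sA := hA.smoothNear
  have sB := hB.smoothNear
  have sV := hV.smoothNear
  have hbr : VectorField.mlieBracket I B A y = proj D (nabla B A) y - proj D (nabla A B) y := by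
    rw [← (D y).starProjection_eq_self_iff.2 hAB, mlieBracket_eq sB sA, map_sub]
    rfl
  rw [curvature_eq, hbr, h.leviCivita_nabla_eq_sub sA sV, h.leviCivita_nabla_eq_sub sB sV,
    inner_shape_left hB.mem, inner_shape_left hB.mem, inner_shape_left hB.mem,
    inner_shape_left hB.mem]
  simp only [sub_apply, map_sub, inner_sub_left, nabla]
  ring

/-- The tangential part S_V A of ∇_A V drops out, since ∇_U keeps it in D, orthogonal to U. -/
theorem inner_curvature_mixed_perp (hA : IsSectionNear D A y) (hU : IsSectionNear (perp D) U y)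
    (hV : IsSectionNear (perp D) V y) :
    (inner ℝ (curvature U A V y) (U y) : ℝ) =
      -(inner ℝ (normalConn D A (normalConn D U V) y) (U y)
        - inner ℝ (normalConn D U (normalConn D A V) y) (U y)
        - inner ℝ (normalConn D (normalConn D A U) V y) (U y)
        + inner ℝ (leviCivita V y (shape D U A y)) (U y)
        + inner ℝ (leviCivita V y (nabla U A y)) (U y)) := by
  have sA := hA.smoothNear
  have sU := hU.smoothNear
  have sV := hV.smoothNear
  have t : (inner ℝ (leviCivita (shape D V A) y (U y)) (U y) : ℝ) = 0 :=
    inner_eq_zero_of_mem_perp (h.leviCivita_mem (h.isSectionNear_shape sA sV) hU.mem) hU.mem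
  rw [curvature_eq, h.leviCivita_nabla hU hV, h.leviCivita_nabla_eq_sub sA sV,
    mlieBracket_eq_shape (D := D) sU sA, inner_normalConn_left hU.mem, inner_normalConn_left hU.mem,
    inner_normalConn_left hU.mem]
  simp only [sub_apply, map_sub, map_add, inner_sub_left, inner_add_left, t]
  ring

-- For frame fields the defect of symmetry is, up to sign, ⟨[d_i, d_j], V⟩, as the torsion vanishes.
-- Both sides are bilinear in u and v, so the frame suffices, and brackets need to lie in D only at
-- y.
omit [Fintype ι] [Fintype κ] in
theorem leviCivita_symm (hbr : ∀ i j, VectorField.mlieBracket I (d i) (d j) y ∈ D y)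
    (hV : IsSectionNear (perp D) V y) {u v : TangentSpace I y} (hu : u ∈ D y) (hv : v ∈ D y) :
    (inner ℝ (leviCivita V y u) v : ℝ) = inner ℝ u (leviCivita V y v) := by
  have hsec : ∀ i, IsSectionNear D (d i) y := fun i ↦ isSectionNear_iff.2 ⟨h.frame.smooth i, by
    filter_upwards [h.frame.span] with z hz
    exact hz ▸ Submodule.subset_span ⟨i, rfl⟩⟩
  have hij : ∀ i j, (inner ℝ (leviCivita V y (d i y)) (d j y) : ℝ)
      = inner ℝ (d i y) (leviCivita V y (d j y)) := by
    intro i j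
    have h1 := inner_leviCivita_perp (hsec j) hV (d i y)
    have h2 := inner_leviCivita_perp (hsec i) hV (d j y)
    have h3 := inner_eq_zero_of_mem_perp (hbr i j) hV.mem
    rw [mlieBracket_eq (h.frame.smooth i) (h.frame.smooth j), nabla, nabla, inner_sub_left] at h3
    rw [real_inner_comm]
    linarith
  have hspan := h.frame.span.self_of_nhds
  rw [← hspan] at hu hv
  induction hu using Submodule.span_induction with
  | zero => simp
  | add u u' _ _ h1 h2 => simp [inner_add_left, h1, h2]
  | smul c u _ h1 => simp [inner_smul_left, h1]
  | mem u hu =>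
    obtain ⟨i, rfl⟩ := hu
    induction hv using Submodule.span_induction with
    | zero => simp
    | add v v' _ _ h1 h2 => simp [inner_add_right, h1, h2]
    | smul c v _ h1 => simp [inner_smul_right, h1]
    | mem v hv =>
      obtain ⟨j, rfl⟩ := hv
      exact hij i j

end IsGeodesicSplitting

end Splitting

/-! ### Riemannian maps, adjoints and related connections. -/

section RiemannianMap

variable {E : Type*} [NormedAddCommGroup E] [NormedSpace ℝ E] [FiniteDimensional ℝ E]
  {H : Type*} [TopologicalSpace H] {I : ModelWithCorners ℝ E H}
  {M : Type*} [TopologicalSpace M] [ChartedSpace H M] [IsManifold I ∞ M]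
  {E' : Type*} [NormedAddCommGroup E'] [NormedSpace ℝ E'] [FiniteDimensional ℝ E']
  {H' : Type*} [TopologicalSpace H'] {J : ModelWithCorners ℝ E' H'}
  {N : Type*} [TopologicalSpace N] [ChartedSpace H' N] [IsManifold J ∞ N]
  [Bundle.RiemannianBundle (fun q : M ↦ TangentSpace I q)]
  [Bundle.RiemannianBundle (fun y : N ↦ TangentSpace J y)]
  {F : M → N} {p : M}

-- The witness is the horizontal part of w. It makes the isometry property available with only one
-- argument horizontal, which gives *F_* F_* u = u for horizontal u.
omit [IsManifold I ∞ M] [FiniteDimensional ℝ E'] [IsManifold J ∞ N] in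
theorem exists_horizontal (F : M → N) {q : M} (w : TangentSpace I q) :
    ∃ u ∈ horizontal I J F q, mfderiv I J F q u = mfderiv I J F q w
      ∧ ∀ v ∈ horizontal I J F q, (inner ℝ v u : ℝ) = inner ℝ v w := by
  set K := LinearMap.ker (mfderiv I J F q).toLinearMap
  refine ⟨w - K.starProjection w, K.sub_starProjection_mem_orthogonal w, ?_, fun v hv ↦ ?_⟩
  · have : mfderiv I J F q (K.starProjection w) = 0 :=
      LinearMap.mem_ker.1 (K.starProjection_apply_mem w)
    rw [map_sub, this, sub_zero]
  · rw [inner_sub_right, Submodule.inner_left_of_mem_orthogonal (K.starProjection_apply_mem w) hv,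
      sub_zero]

namespace IsRiemannianMap

variable (hF : IsRiemannianMap I J F)
include hF

omit [IsManifold I ∞ M] [FiniteDimensional ℝ E'] [IsManifold J ∞ N] in
theorem inner_mfderiv {q : M} {u : TangentSpace I q} (hu : u ∈ horizontal I J F q)
    (w : TangentSpace I q) :
    (inner ℝ (mfderiv I J F q u) (mfderiv I J F q w) : ℝ) = inner ℝ u w := by
  obtain ⟨w', hw', h1, h2⟩ := exists_horizontal (J := J) F w
  rw [← h1, hF.2 q u hu w' hw', h2 u hu]

omit [IsManifold I ∞ M] [IsManifold J ∞ N] in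
theorem adjointDiff_mfderiv {q : M} {u : TangentSpace I q} (hu : u ∈ horizontal I J F q) :
    adjointDiff I J F q (mfderiv I J F q u) = u := by
  refine ext_inner_right ℝ fun w ↦ ?_
  rw [adjointDiff, LinearMap.adjoint_inner_left]
  exact hF.inner_mfderiv hu w

omit [IsManifold I ∞ M] [IsManifold J ∞ N] in
theorem adjointDiff_of_mem {q : M} {v : TangentSpace J (F q)} (hv : v ∈ rangeDiff I J F q) :
    adjointDiff I J F q v ∈ horizontal I J F q
      ∧ mfderiv I J F q (adjointDiff I J F q v) = v := by
  obtain ⟨w, rfl⟩ := hv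
  obtain ⟨u, hu, h1, -⟩ := exists_horizontal (J := J) F w
  have h2 : (mfderiv I J F q).toLinearMap w = mfderiv I J F q u := h1.symm
  rw [h2, hF.adjointDiff_mfderiv hu]
  exact ⟨hu, rfl⟩

variable [IsContMDiffRiemannianBundle I ∞ E (fun q : M ↦ TangentSpace I q)]
  [IsContMDiffRiemannianBundle J ∞ E' (fun y : N ↦ TangentSpace J y)]

/-- The Levi-Civita connections of related horizontal fields correspond to each other. -/
theorem inner_nabla {X Z T : Π q : M, TangentSpace I q} {A C G : Π y : N, TangentSpace J y}
    (hX : IsSectionNear (horizontal I J F) X p) (hZ : IsSectionNear (horizontal I J F) Z p)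
    (hT : IsSectionNear (horizontal I J F) T p)
    (hA : SmoothNear J A (F p)) (hC : SmoothNear J C (F p)) (hG : SmoothNear J G (F p))
    (hXA : IsPushforwardNear F X A p) (hZC : IsPushforwardNear F Z C p)
    (hTG : IsPushforwardNear F T G p) :
    (inner ℝ (nabla X Z p) (T p) : ℝ) = inner ℝ (nabla A C (F p)) (G (F p)) := by
  -- Each of the six Koszul terms is the same on M and on N. For the derivative terms, ⟨Z, T⟩ = ⟨C,
  -- G⟩ ∘ F near p.
  have hder : ∀ {X Z T : Π q : M, TangentSpace I q} {A C G : Π y : N, TangentSpace J y},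
      IsSectionNear (horizontal I J F) Z p → SmoothNear J C (F p) → SmoothNear J G (F p) →
      IsPushforwardNear F X A p → IsPushforwardNear F Z C p → IsPushforwardNear F T G p →
      mvfderiv I (fun q ↦ (inner ℝ (Z q) (T q) : ℝ)) p (X p)
        = mvfderiv J (fun y ↦ (inner ℝ (C y) (G y) : ℝ)) (F p) (A (F p)) := by
    intro X Z T A C G hZ hC hG hXA hZC hTG
    have h1 : mvfderiv I (fun q ↦ (inner ℝ (Z q) (T q) : ℝ)) p
        = mvfderiv I ((fun y ↦ (inner ℝ (C y) (G y) : ℝ)) ∘ F) p := by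
      refine Filter.EventuallyEq.mfderiv_eq ?_
      filter_upwards [hZ.eventually_mem, hZC, hTG] with q h1 h2 h3
      rw [← hF.inner_mfderiv h1, h2, h3]
      rfl
    rw [h1, mvfderiv_comp_mfderiv (hC.inner hG).mdifferentiableAt
      (hF.1.contMDiffAt.mdifferentiableAt (by simp)), hXA.self_of_nhds]
  -- The bracket on M need not be horizontal, but pairing it with the horizontal T ignores its
  -- vertical part.
  have hbr : ∀ {X Z T : Π q : M, TangentSpace I q} {A C G : Π y : N, TangentSpace J y},
      SmoothNear I X p → SmoothNear I Z p → IsSectionNear (horizontal I J F) T p →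
      SmoothNear J A (F p) → SmoothNear J C (F p) →
      IsPushforwardNear F X A p → IsPushforwardNear F Z C p → IsPushforwardNear F T G p →
      (inner ℝ (VectorField.mlieBracket I X Z p) (T p) : ℝ)
        = inner ℝ (VectorField.mlieBracket J A C (F p)) (G (F p)) := by
    intro X Z T A C G hX hZ hT hA hC hXA hZC hTG
    rw [real_inner_comm, ← hF.inner_mfderiv hT.mem, mfderiv_mlieBracket hF.1 hX hZ hA hC hXA hZC,
      hTG.self_of_nhds, real_inner_comm]
  have sX := hX.smoothNear
  have sZ := hZ.smoothNear
  have sT := hT.smoothNear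
  rw [nabla, nabla, inner_leviCivita sX.mdifferentiableAt sZ.mdifferentiableAt
    sT.mdifferentiableAt, inner_leviCivita hA.mdifferentiableAt hC.mdifferentiableAt
    hG.mdifferentiableAt, koszul, koszul, hder hZ hC hG hXA hZC hTG, hder hT hG hA hZC hTG hXA,
    hder hX hA hC hTG hXA hZC, hbr sX sZ hT hA hC hXA hZC hTG, hbr sX sT hZ hA hG hXA hTG hZC,
    hbr sZ sT hX hC hG hZC hTG hXA]

variable {D : Π y : N, Submodule ℝ (TangentSpace J y)}
  {ι : Type*} [Fintype ι] {ξ : ι → Π q : M, TangentSpace I q} {d : ι → Π y : N, TangentSpace J y}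
  {C : Π y : N, TangentSpace J y}

-- Smoothness comes from the expansion *F_*(C ∘ F) = Σ_j (⟨d_j, C⟩ ∘ F) ξ_j near p, valid because
-- *F_* sends d_j ∘ F to ξ_j.
omit [IsContMDiffRiemannianBundle I ∞ E (fun q : M ↦ TangentSpace I q)] in
theorem isSectionNear_adjointDiff (hDF : ∀ q : M, D (F q) = rangeDiff I J F q)
    (hξ : ∀ j, IsSectionNear (horizontal I J F) (ξ j) p)
    (hξd : ∀ j, IsPushforwardNear F (ξ j) (d j) p) (hd : IsFrameNear D d (F p))
    (hC : IsSectionNear D C (F p)) :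
    IsSectionNear (horizontal I J F) (fun q ↦ adjointDiff I J F q (C (F q))) p
      ∧ IsPushforwardNear F (fun q ↦ adjointDiff I J F q (C (F q))) C p := by
  have hFt := hF.1.continuous.continuousAt (x := p).tendsto
  have hmem : ∀ᶠ q in 𝓝 p, C (F q) ∈ rangeDiff I J F q := by
    filter_upwards [hFt.eventually hC.eventually_mem] with q hq
    exact hDF q ▸ hq
  refine ⟨isSectionNear_iff.2 ⟨?_, ?_⟩, ?_⟩
  · have hs : SmoothNear I (fun q ↦ ∑ j,
        (((fun y ↦ (inner ℝ (d j y) (C y) : ℝ)) ∘ F) • ξ j) q) p :=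
      SmoothNear.sum fun j _ ↦
        (hξ j).smoothNear.smul (((hd.smooth j).inner hC.smoothNear).comp hF.1)
    refine hs.congr ?_
    filter_upwards [hFt.eventually hC.eventually_mem, hFt.eventually hd.orthonormal,
      hFt.eventually hd.span, Filter.eventually_all.2 fun j ↦ (hξ j).eventually_mem,
      Filter.eventually_all.2 hξd] with q h1 h2 h3 h4 h5
    have := sum_inner_smul_of_mem_span h2 (h3.symm ▸ h1)
    conv_lhs => rw [← this]
    rw [map_sum]
    refine Finset.sum_congr rfl fun j _ ↦ ?_
    rw [map_smul, ← h5 j, hF.adjointDiff_mfderiv (h4 j), h5 j]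
    rfl
  · filter_upwards [hmem] with q hq using (hF.adjointDiff_of_mem hq).1
  · filter_upwards [hmem] with q hq using (hF.adjointDiff_of_mem hq).2

/-- The component of `∇_{F_* X} C` on `range F_*` is the image of `∇_X (*F_* C)`. -/
theorem inner_mfderiv_nabla_adjointDiff {X T : Π q : M, TangentSpace I q}
    {A G : Π y : N, TangentSpace J y} (hDF : ∀ q : M, D (F q) = rangeDiff I J F q)
    (hξ : ∀ j, IsSectionNear (horizontal I J F) (ξ j) p)
    (hξd : ∀ j, IsPushforwardNear F (ξ j) (d j) p) (hd : IsFrameNear D d (F p))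
    (hC : IsSectionNear D C (F p))
    (hX : IsSectionNear (horizontal I J F) X p) (hT : IsSectionNear (horizontal I J F) T p)
    (hA : SmoothNear J A (F p)) (hG : SmoothNear J G (F p))
    (hXA : IsPushforwardNear F X A p) (hTG : IsPushforwardNear F T G p) :
    (inner ℝ (mfderiv I J F p (nabla X (fun q ↦ adjointDiff I J F q (C (F q))) p)) (G (F p)) : ℝ)
      = inner ℝ (nabla A C (F p)) (G (F p)) := by
  obtain ⟨hZ, hZC⟩ := hF.isSectionNear_adjointDiff hDF hξ hξd hd hC
  rw [← hF.inner_nabla hX hZ hT hA hC.smoothNear hG hXA hZC hTG, ← hTG.self_of_nhds,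
    real_inner_comm, hF.inner_mfderiv hT.mem, real_inner_comm]

end IsRiemannianMap

end RiemannianMap

end RiemGeom

end

/-! ### The Ricci formulas. -/

theorem theorem3p3 {m n : ℕ}
    {M : Type*} [TopologicalSpace M] [ChartedSpace (EuclideanSpace ℝ (Fin m)) M]
    [IsManifold (𝓡 m) ∞ M]
    [Bundle.RiemannianBundle (fun q : M ↦ TangentSpace (𝓡 m) q)]
    [IsContMDiffRiemannianBundle (𝓡 m) ∞ (EuclideanSpace ℝ (Fin m))
      (fun q : M ↦ TangentSpace (𝓡 m) q)]
    {N : Type*} [TopologicalSpace N] [ChartedSpace (EuclideanSpace ℝ (Fin n)) N]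
    [IsManifold (𝓡 n) ∞ N]
    [Bundle.RiemannianBundle (fun y : N ↦ TangentSpace (𝓡 n) y)]
    [IsContMDiffRiemannianBundle (𝓡 n) ∞ (EuclideanSpace ℝ (Fin n))
      (fun y : N ↦ TangentSpace (𝓡 n) y)]
    (F : M → N) (hF : RiemGeom.IsRiemannianMap (𝓡 m) (𝓡 n) F)
    -- the distribution `D = range F_*` on a neighbourhood of the image of `F`
    (O : Set N) (hO : IsOpen O) (hFO : Set.range F ⊆ O)
    (D : Π y : N, Submodule ℝ (TangentSpace (𝓡 n) y))
    (hD : RiemGeom.IsSmoothDistributionOn D O)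
    (hDF : ∀ p : M, D (F p) = RiemGeom.rangeDiff (𝓡 m) (𝓡 n) F p)
    (hTG : RiemGeom.IsTotallyGeodesicOn (RiemGeom.perp D) O)
    (p : M)
    -- `X`, `Y` are horizontal, `FX = F_* X` and `FY = F_* Y`
    (X Y : Π q : M, TangentSpace (𝓡 m) q) (FX FY : Π y : N, TangentSpace (𝓡 n) y)
    (hX : RiemGeom.IsSectionNear (RiemGeom.horizontal (𝓡 m) (𝓡 n) F) X p)
    (hY : RiemGeom.IsSectionNear (RiemGeom.horizontal (𝓡 m) (𝓡 n) F) Y p)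
    (hFX : RiemGeom.IsSectionNear D FX (F p)) (hFY : RiemGeom.IsSectionNear D FY (F p))
    (hXF : RiemGeom.IsPushforwardNear F X FX p) (hYF : RiemGeom.IsPushforwardNear F Y FY p)
    -- `V`, `W` are sections of the orthogonal complement
    (V W : Π y : N, TangentSpace (𝓡 n) y)
    (hV : RiemGeom.IsSectionNear (RiemGeom.perp D) V (F p))
    (hW : RiemGeom.IsSectionNear (RiemGeom.perp D) W (F p))
    -- orthonormal frames `Fξ j = F_* (ξ j)` of `D` and `e k` of the orthogonal complement
    {d n₁ : ℕ} (ξ : Fin d → Π q : M, TangentSpace (𝓡 m) q)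
    (Fξ : Fin d → Π y : N, TangentSpace (𝓡 n) y)
    (e : Fin n₁ → Π y : N, TangentSpace (𝓡 n) y)
    (hξ : ∀ j, RiemGeom.IsSectionNear (RiemGeom.horizontal (𝓡 m) (𝓡 n) F) (ξ j) p)
    (hξF : ∀ j, RiemGeom.IsPushforwardNear F (ξ j) (Fξ j) p)
    (hFξ : RiemGeom.IsOrthonormalFrameNear D Fξ (F p))
    (he : RiemGeom.IsOrthonormalFrameNear (RiemGeom.perp D) e (F p)) :
    -- the Ricci tensor on `range F_*`
    (RiemGeom.ricci (F p) (FX (F p)) (FY (F p)) =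
      RiemGeom.partialRicci (D (F p)) (FX (F p)) (FY (F p))
      - ∑ k, (inner ℝ (RiemGeom.shape D (RiemGeom.normalConn D (e k) (e k)) FX (F p)) (FY (F p))
          - inner ℝ (RiemGeom.nabla (e k) (RiemGeom.shape D (e k) FX) (F p)) (FY (F p))
          + inner ℝ (RiemGeom.shape D (e k) FX (F p)) (RiemGeom.shape D (e k) FY (F p))
          + inner ℝ (RiemGeom.nabla (e k) FX (F p)) (RiemGeom.shape D (e k) FY (F p)))) ∧
    -- the Ricci tensor on the orthogonal complement
    (RiemGeom.ricci (F p) (V (F p)) (W (F p)) =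
      RiemGeom.partialRicci (RiemGeom.perp D (F p)) (V (F p)) (W (F p))
      - ∑ j, (inner ℝ (RiemGeom.shape D (RiemGeom.normalConn D V W) (Fξ j) (F p)) (Fξ j (F p))
          + inner ℝ (RiemGeom.shape D V (Fξ j) (F p)) (RiemGeom.shape D W (Fξ j) (F p))
          - mvfderiv (𝓡 n) (fun y ↦ inner ℝ (RiemGeom.shape D W (Fξ j) y) (Fξ j y)) (F p) (V (F p))
          + 2 * inner ℝ (RiemGeom.shape D W (Fξ j) (F p)) (RiemGeom.nabla V (Fξ j) (F p)))) ∧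
    -- there the partial Ricci tensor is the intrinsic one, that of the connection `∇^{F⊥}`
    (RiemGeom.partialRicci (RiemGeom.perp D (F p)) (V (F p)) (W (F p)) =
      ∑ k, inner ℝ (RiemGeom.normalCurvature D (e k) V W (F p)) (e k (F p))) ∧
    -- the Ricci tensor on mixed pairs
    (RiemGeom.ricci (F p) (FX (F p)) (V (F p)) =
      ∑ j, (inner ℝ (RiemGeom.covDerivShape F D X FX V (Fξ j) p) (Fξ j (F p))
          - inner ℝ (RiemGeom.covDerivShape F D (ξ j) (Fξ j) V FX p) (Fξ j (F p)))
      - ∑ k, inner ℝ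
          (RiemGeom.normalConn D FX (RiemGeom.normalConn D (e k) V) (F p)
            - RiemGeom.normalConn D (e k) (RiemGeom.normalConn D FX V) (F p)
            - RiemGeom.normalConn D (RiemGeom.normalConn D FX (e k)) V (F p)
            + RiemGeom.normalConnAlong (𝓡 m) F D p
                (RiemGeom.adjointDiff (𝓡 m) (𝓡 n) F p (RiemGeom.shape D (e k) FX (F p))) V
            + RiemGeom.normalConnAlong (𝓡 m) F D p
                (RiemGeom.adjointDiff (𝓡 m) (𝓡 n) F p (RiemGeom.nabla (e k) FX (F p))) V)
          (e k (F p))) := by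
  have hd := hFξ.isFrameNear
  have he' := he.isFrameNear
  have h := hTG.isGeodesicSplitting hO (hFO ⟨p, rfl⟩) hd he'
  have hsd : ∀ j, RiemGeom.IsSectionNear D (Fξ j) (F p) := hFξ.1
  have hse : ∀ k, RiemGeom.IsSectionNear (RiemGeom.perp D) (e k) (F p) := he.1
  have hbr : ∀ {Z T : Π q : M, TangentSpace (𝓡 m) q} {A C : Π y : N, TangentSpace (𝓡 n) y},
      RiemGeom.IsSectionNear (RiemGeom.horizontal (𝓡 m) (𝓡 n) F) Z p →
      RiemGeom.IsSectionNear (RiemGeom.horizontal (𝓡 m) (𝓡 n) F) T p →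
      RiemGeom.IsSectionNear D A (F p) → RiemGeom.IsSectionNear D C (F p) →
      RiemGeom.IsPushforwardNear F Z A p → RiemGeom.IsPushforwardNear F T C p →
      VectorField.mlieBracket (𝓡 n) A C (F p) ∈ D (F p) := by
    intro Z T A C hZ hT hA hC hZA hTC
    -- At `F p` the bracket is the image of a bracket on M, hence in the range, although D may fail
    -- to be integrable.
    rw [← RiemGeom.mfderiv_mlieBracket hF.1 hZ.smoothNear hT.smoothNear hA.smoothNear
      hC.smoothNear hZA hTC, hDF p]
    exact ⟨_, rfl⟩
  have hsym : ∀ U, RiemGeom.IsSectionNear (RiemGeom.perp D) U (F p) →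
      ∀ u ∈ D (F p), ∀ v ∈ D (F p), (inner ℝ (RiemGeom.leviCivita U (F p) u) v : ℝ)
        = inner ℝ u (RiemGeom.leviCivita U (F p) v) := fun U hU u hu v hv ↦
    h.leviCivita_symm (fun i j ↦ hbr (hξ i) (hξ j) (hsd i) (hsd j) (hξF i) (hξF j)) hU hu hv
  refine ⟨?_, ?_, ?_, ?_⟩
  · rw [RiemGeom.ricci_eq_sum h.full, Fintype.sum_sum_type,
      RiemGeom.partialRicci_eq_sum h.full hd, sub_eq_add_neg, ← Finset.sum_neg_distrib]
    refine congrArg₂ _ rfl (Finset.sum_congr rfl fun k _ ↦ ?_)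
    rw [Sum.elim_inr, RiemGeom.curvatureAt_eq h.full (he'.smooth k) hFX.smoothNear hFY.smoothNear]
    exact h.inner_curvature_perp_range hFX hFY (hse k) (hsym _ (hse k))
  · rw [RiemGeom.ricci_eq_sum h.full, Fintype.sum_sum_type,
      -- The combined frame lists D first, whereas here the partial Ricci tensor is the sum over the
      -- complement.
      RiemGeom.partialRicci_eq_sum h.full he', sub_eq_add_neg, ← Finset.sum_neg_distrib, add_comm]
    refine congrArg₂ _ rfl (Finset.sum_congr rfl fun j _ ↦ ?_)
    rw [Sum.elim_inl, RiemGeom.curvatureAt_eq h.full (hd.smooth j) hV.smoothNear hW.smoothNear]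
    exact h.inner_curvature_range_perp (hsd j) hV hW (hsym W hW)
  · rw [RiemGeom.partialRicci_eq_sum h.full he']
    refine Finset.sum_congr rfl fun k _ ↦ ?_
    rw [RiemGeom.curvatureAt_eq h.full (he'.smooth k) hV.smoothNear hW.smoothNear]
    exact h.inner_curvature_perp (hse k) hV hW
  · rw [RiemGeom.ricci_eq_sum h.full, Fintype.sum_sum_type, sub_eq_add_neg,
      ← Finset.sum_neg_distrib]
    refine congrArg₂ _ (Finset.sum_congr rfl fun j _ ↦ ?_) (Finset.sum_congr rfl fun k _ ↦ ?_)
    · rw [Sum.elim_inl, RiemGeom.curvatureAt_eq h.full (hd.smooth j) hFX.smoothNear hV.smoothNear,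
        h.inner_curvature_mixed_range hFX (hsd j) hV
          (hbr (hξ j) hX (hsd j) hFX (hξF j) hXF),
        RiemGeom.covDerivShape, RiemGeom.covDerivShape, inner_sub_left, inner_sub_left,
        inner_sub_left, inner_sub_left,
        hF.inner_mfderiv_nabla_adjointDiff hDF hξ hξF hd
          (h.isSectionNear_shape (hd.smooth j) hV.smoothNear) hX (hξ j) hFX.smoothNear
          (hd.smooth j) hXF (hξF j),
        hF.inner_mfderiv_nabla_adjointDiff hDF hξ hξF hd
          (h.isSectionNear_shape hFX.smoothNear hV.smoothNear) (hξ j) (hξ j) (hd.smooth j)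
          (hd.smooth j) (hξF j) (hξF j)]
    -- F_* *F_* is the identity on the range. This applies to S_{e_k} F_* X and, by total geodesy,
    -- to ∇_{e_k} F_* X.
    · have hadj : ∀ u ∈ D (F p), (inner ℝ (RiemGeom.normalConnAlong (𝓡 m) F D p
          (RiemGeom.adjointDiff (𝓡 m) (𝓡 n) F p u) V) (e k (F p)) : ℝ)
            = inner ℝ (RiemGeom.leviCivita V (F p) u) (e k (F p)) := by
        intro u hu
        have hek := (hse k).mem
        rw [RiemGeom.normalConnAlong, (hF.adjointDiff_of_mem (hDF p ▸ hu)).2,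
          Submodule.inner_starProjection_left_eq_right,
          Submodule.starProjection_eq_self_iff.2 hek]
      rw [Sum.elim_inr, RiemGeom.curvatureAt_eq h.full (he'.smooth k) hFX.smoothNear hV.smoothNear,
        h.inner_curvature_mixed_perp hFX (hse k) hV, inner_add_left, inner_add_left,
        inner_sub_left, inner_sub_left, hadj _ (RiemGeom.shape_mem D _ _ _),
        hadj _ (h.isSectionNear_nabla (hse k) hFX).mem]
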